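/- Let $U$ be a finite set, let $w:U\to\{1,2,3,\dots\}$ be a weight function, and let $\mathbf A=(A_1,\dots,A_l)$ be nonempty subsets of $U$. For $X\in\{0,1\}^l$ let \[C_{\mathbf A}(X)=\min\Big\{\sum_{u\in H}w(u)\;:\;H\subseteq U,\ H\cap A_i\neq\emptyset\text{ for all } i \text{ with } X_i=1\Big\}.\] For a collection $F=(f_1,\dots,f_l)$ of functions $f_i:\{0,1\}^n\to\{0,1\}$ let $C_F(X)$ be the minimum depth of a deterministic adaptive decision tree that on input $x\in\{0,1\}^n$ outputs the values $f_i(x)$ for all $i$ with $X_i=1$. A bin function with keyspace $[M]$ is a map $\mathbf B$ from $\{0,1\}^m$, for some $m$, to the subsets of $[M]$ of size at most $1$. For real $T'>0$ and $\delta\in(0,1)$ it is a $(T',\delta)$-mystery bin function if: (i) some decision tree of depth at most $T'$ computes $\mathbf B(y)$; (ii) for each $k\in[M]$, some decision tree of depth at most $\delta T'$ decides whether $k\in\mathbf B(y)$; (iii) there is an adversary strategy for answering queries to the bits of $y$, each answer depending only on the queries and answers so far and the current query, such that for every adaptive query strategy making at most $(1-\delta)T'$ queries there are at least $(1-\delta)M$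 keys $k\in[M]$ for which the answers given are consistent with $\mathbf B(y)=\{k\}$. **Lemma.** For all $U,w,\mathbf A$ as above, every real $\epsilon>0$ and every $\delta\in(0,1)$, there exist integers $n\ge 0$, $T>0$, $M>0$, a partition of the $n$ coordinates of $x\in\{0,1\}^n$ into blocks $y_u$ ($u\in U$), for each $u\in U$ a $(w(u)T,\delta)$-mystery bin function $\mathbf B_u$ with keyspace $[M]$ whose input is the block $y_u$, and nonconstant functions $f_1,\dots,f_l:\{0,1\}^n\to\{0,1\}$ such that, for all $i$ and $x$, \[f_i(x)=1\iff\exists k\in[M]\ \forall u\in A_i:\ \mathbf B_u(y_u)=\{k\},\] and such that, with $F=(f_1,\dots,f_l)$, for all $X\in\{0,1\}^l$, \[C_{\mathbf A}(X)\cdot T(1-\epsilon)\le C_F(X)\le C_{\mathbf A}(X)\cdot T(1+\epsilon).\] -/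

import Mathlib

namespace Multitask

/-- A deterministic adaptive decision tree querying Boolean variables indexed by `ι`, with output
labels in `β`. At an internal node the left child is taken when the queried bit is `0` (`false`)
and the right child when it is `1` (`true`). -/
inductive DecisionTree (ι : Type*) (β : Type*) where
  | leaf (v : β) : DecisionTree ι β
  | node (i : ι) (left right : DecisionTree ι β) : DecisionTree ι β

namespace DecisionTree

variable {ι : Type*} {β : Type*}

/-- The value computed by the tree on the input `x`. -/
def eval : DecisionTree ι β → (ι → Bool) → β
  | leaf v, _ => v
  | node i left right, x => if x i = true then right.eval x else left.eval x

/-- The length of a longest path from the root. -/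
def depth : DecisionTree ι β → ℕ
  | leaf _ => 0
  | node _ left right => max left.depth right.depth + 1

/-- The list of queries and answers, most recent first, that arises when the tree is run from the
history `h` and an adversary `σ` answers its queries. The answer of the adversary may depend only
on the queries and answers so far and on the current query. -/
def transcript (σ : List (ι × Bool) → ι → Bool) :
    DecisionTree ι β → List (ι × Bool) → List (ι × Bool)
  | leaf _, h => h
  | node i left right, h =>
      if σ h i = true then right.transcript σ ((i, true) :: h)
      else left.transcript σ ((i, false) :: h)

end DecisionTree

/-- The query complexity of a function: the minimum depth of a decision tree computing it. -/
noncomputable def queryComplexity {ι β : Type*} (f : (ι → Bool) → β) : ℕ :=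
  sInf {d : ℕ | ∃ P : DecisionTree ι β, P.depth = d ∧ ∀ x, P.eval x = f x}

/-- Every function of finitely many bits is computed by a decision tree, so that the minimum in
`queryComplexity` is over a nonempty set. -/
theorem exists_decisionTree {ι β : Type*} [Fintype ι] (f : (ι → Bool) → β) :
    ∃ P : DecisionTree ι β, ∀ x, P.eval x = f x := by
  classical
  have key : ∀ (s : Finset ι) (g : (ι → Bool) → β),
      (∀ x y : ι → Bool, (∀ i ∈ s, x i = y i) → g x = g y) →
      ∃ P : DecisionTree ι β, ∀ x, P.eval x = g x := by
    intro s
    induction s using Finset.induction_on with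
    | empty =>
      intro g hg
      exact ⟨.leaf (g fun _ => false), fun x => hg _ _ (by simp)⟩
    | insert a s _ ih =>
      intro g hg
      have step : ∀ b : Bool, ∃ P : DecisionTree ι β,
          ∀ x, P.eval x = g (Function.update x a b) := by
        intro b
        refine ih _ fun x y hxy => hg _ _ fun i _ => ?_
        by_cases hi : i = a
        · subst hi; simp
        · simp only [Function.update_of_ne hi]
          exact hxy i (by simp_all)
      obtain ⟨P, hP⟩ := step false
      obtain ⟨Q, hQ⟩ := step true
      refine ⟨.node a P Q, fun x => ?_⟩
      cases hx : x a
      · have : Function.update x a false = x := by rw [← hx]; simp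
        simp [DecisionTree.eval, hx, hP, this]
      · have : Function.update x a true = x := by rw [← hx]; simp
        simp [DecisionTree.eval, hx, hQ, this]
  exact key Finset.univ f fun x y hxy => congrArg f (funext fun i => hxy i (Finset.mem_univ i))

/-- The multitask cost function `C_F` of a collection `F = (f_1, …, f_l)` of Boolean functions on
`n` bits: `C_F X` is the query complexity of computing all `f_i x` with `X_i = 1`. -/
noncomputable def multitaskCost {n l : ℕ} (f : Fin l → (Fin n → Bool) → Bool)
    (X : Fin l → Bool) : ℕ :=
  queryComplexity fun (x : Fin n → Bool) (i : {i : Fin l // X i = true}) => f i x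

/-- `B` is a hitting set for the family `S`: it meets every member of `S`. -/
def IsHittingSet {U : Type*} (B : Finset U) (S : Set (Finset U)) : Prop :=
  ∀ A ∈ S, ∃ u ∈ B, u ∈ A

/-- The weighted hitting set cost `ρ(S)` of the family `S` relative to the weights `w`. -/
noncomputable def hittingCost {U : Type*} (w : U → ℕ) (S : Set (Finset U)) : ℕ :=
  sInf {c : ℕ | ∃ B : Finset U, IsHittingSet B S ∧ ∑ u ∈ B, w u ≤ c}

/-- The weighted hitting set cost function `C_A(X) = ρ(S_X)`, where `S_X = {A_i : X_i = 1}`. -/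
noncomputable def hittingSetCost {U : Type*} {l : ℕ} (w : U → ℕ) (A : Fin l → Finset U)
    (X : Fin l → Bool) : ℕ :=
  hittingCost w {S | ∃ i, X i = true ∧ A i = S}

/-- If all members of a family over a finite ground set are nonempty then the minimum in
`hittingCost` is over a nonempty set. -/
theorem exists_isHittingSet {U : Type*} [Fintype U] (S : Set (Finset U))
    (hS : ∀ A ∈ S, A.Nonempty) : ∃ B : Finset U, IsHittingSet B S :=
  ⟨Finset.univ, fun A hA => (hS A hA).imp fun u hu => ⟨Finset.mem_univ u, hu⟩⟩

/-- A bin function: it maps a bin `y`, an `m`-bit string, to its contents, which is either empty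
(`none`) or a single key (`some k`) from the keyspace of size `M`. -/
abbrev BinFunction (m M : ℕ) := (Fin m → Bool) → Option (Fin M)

/-- The bin function has security `β` for `q` queries: some adversary answers the queries in such a
way that, against any query strategy making at most `q` queries, for at least a `β` fraction of the
keys `k` the bits seen are consistent with `k` being in the bin. -/
def BinFunction.Secure {m M : ℕ} (B : BinFunction m M) (q : ℕ) (β : ℝ) : Prop :=
  ∃ σ : List (Fin m × Bool) → Fin m → Bool,
    ∀ P : DecisionTree (Fin m) Unit, P.depth ≤ q →
      ∃ H : Finset (Fin M), β * M ≤ H.card ∧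
        ∀ k ∈ H, ∃ y : Fin m → Bool, (∀ a ∈ P.transcript σ [], y a.1 = a.2) ∧ B y = some k

/-- `(T, δ)`-mystery bin functions. -/
structure BinFunction.IsMysteryBin {m M : ℕ} (B : BinFunction m M) (T δ : ℝ) : Prop where
  T_pos : 0 < T
  delta_pos : 0 < δ
  delta_lt_one : δ < 1
  /-- The contents of the bin can be computed with `T` queries. -/
  computable : ∃ P : DecisionTree (Fin m) (Option (Fin M)),
    (P.depth : ℝ) ≤ T ∧ ∀ y, P.eval y = B y
  /-- It can be decided with `δ T` queries whether a given key is in the bin. -/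
  checkable : ∀ k : Fin M, ∃ P : DecisionTree (Fin m) Bool,
    (P.depth : ℝ) ≤ δ * T ∧ ∀ y, P.eval y = true ↔ B y = some k
  /-- The bin function has security `1 - δ` for `(1 - δ) T` queries. -/
  secure : B.Secure ⌊(1 - δ) * T⌋₊ (1 - δ)

end Multitask

namespace Multitask

namespace DecisionTree

variable {ι κ β γ : Type*}

theorem mem_transcript (σ : List (ι × Bool) → ι → Bool) (P : DecisionTree ι β) :
    ∀ (h : List (ι × Bool)) (a : ι × Bool), a ∈ h → a ∈ P.transcript σ h := by
  induction P with
  | leaf v => intro h a ha; exact ha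
  | node i l r ihl ihr =>
    intro h a ha
    simp only [transcript]
    split_ifs
    · exact ihr _ _ (List.mem_cons_of_mem _ ha)
    · exact ihl _ _ (List.mem_cons_of_mem _ ha)

theorem length_transcript_le (σ : List (ι × Bool) → ι → Bool) (P : DecisionTree ι β) :
    ∀ h : List (ι × Bool), (P.transcript σ h).length ≤ P.depth + h.length := by
  induction P with
  | leaf v => intro h; simp [transcript, depth]
  | node i l r ihl ihr =>
    intro h
    simp only [transcript, depth]
    split_ifs
    · have := ihr ((i, true) :: h); simp only [List.length_cons] at this; omega
    · have := ihl ((i, false) :: h); simp only [List.length_cons] at this; omega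

/-- Inputs that agree with the same transcript are given the same value. -/
theorem eval_eq_of_transcript (σ : List (ι × Bool) → ι → Bool) (P : DecisionTree ι β)
    {x x' : ι → Bool} : ∀ h : List (ι × Bool),
    (∀ a ∈ P.transcript σ h, x a.1 = a.2) → (∀ a ∈ P.transcript σ h, x' a.1 = a.2) →
      P.eval x = P.eval x' := by
  induction P with
  | leaf v => intro h _ _; rfl
  | node i l r ihl ihr =>
    intro h hx hx'
    simp only [transcript] at hx hx'
    simp only [eval]
    split_ifs at hx hx' with hσ
    · have h1 := hx _ (mem_transcript σ r _ (i, true) (by simp))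
      have h2 := hx' _ (mem_transcript σ r _ (i, true) (by simp))
      simp only at h1 h2
      rw [if_pos h1, if_pos h2]
      exact ihr _ hx hx'
    · have h1 := hx _ (mem_transcript σ l _ (i, false) (by simp))
      have h2 := hx' _ (mem_transcript σ l _ (i, false) (by simp))
      simp only at h1 h2
      rw [if_neg (by simp [h1]), if_neg (by simp [h2])]
      exact ihl _ hx hx'

theorem transcript_induction {Good : List (ι × Bool) → Prop} {σ : List (ι × Bool) → ι → Bool}
    (hσ : ∀ h i, Good h → Good ((i, σ h i) :: h)) (P : DecisionTree ι β) :
    ∀ h, Good h → Good (P.transcript σ h) := by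
  induction P with
  | leaf v => intro h hh; exact hh
  | node i l r ihl ihr =>
    intro h hh
    have := hσ h i hh
    simp only [transcript]
    split_ifs with hs
    · rw [hs] at this; exact ihr _ this
    · rw [Bool.not_eq_true] at hs; rw [hs] at this; exact ihl _ this

/-- An invariant of histories that can be maintained whatever is queried is maintained by some
adversary. -/
theorem exists_adversary {Good : List (ι × Bool) → Prop}
    (step : ∀ h i, Good h → ∃ b, Good ((i, b) :: h)) :
    ∃ σ : List (ι × Bool) → ι → Bool, ∀ h i, Good h → Good ((i, σ h i) :: h) := by
  classical
  refine ⟨fun h i => if hh : Good h then (step h i hh).choose else false, fun h i hh => ?_⟩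
  simp only [dif_pos hh]
  exact (step h i hh).choose_spec

/-- Relabelling of the queried variables. -/
def map (e : ι → κ) : DecisionTree ι β → DecisionTree κ β
  | leaf v => leaf v
  | node i l r => node (e i) (l.map e) (r.map e)

theorem depth_map (e : ι → κ) (P : DecisionTree ι β) : (P.map e).depth = P.depth := by
  induction P with
  | leaf v => rfl
  | node i l r ihl ihr => simp [map, depth, ihl, ihr]

theorem eval_map (e : ι → κ) (P : DecisionTree ι β) (x : κ → Bool) :
    (P.map e).eval x = P.eval fun i => x (e i) := by
  induction P with
  | leaf v => rfl
  | node i l r ihl ihr => simp [map, eval, ihl, ihr]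

/-- Run a second tree, depending on the value of the first one. -/
def bind (Q : β → DecisionTree ι γ) : DecisionTree ι β → DecisionTree ι γ
  | leaf v => Q v
  | node i l r => node i (l.bind Q) (r.bind Q)

theorem depth_bind_le (Q : β → DecisionTree ι γ) {d : ℕ} (hQ : ∀ v, (Q v).depth ≤ d)
    (P : DecisionTree ι β) : (P.bind Q).depth ≤ P.depth + d := by
  induction P with
  | leaf v => simpa [bind, depth] using hQ v
  | node i l r ihl ihr => simp only [bind, depth]; omega

theorem eval_bind (Q : β → DecisionTree ι γ) (P : DecisionTree ι β) (x : ι → Bool) :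
    (P.bind Q).eval x = (Q (P.eval x)).eval x := by
  induction P with
  | leaf v => rfl
  | node i l r ihl ihr => simp only [bind, eval, ihl, ihr]; split_ifs <;> rfl

/-- Read the variables in `s`, then use a tree that is correct for the values read. -/
theorem exists_of_read_on (g : (ι → Bool) → β) (s : Finset ι) (d : ℕ) : ∀ C : (ι → Bool) → Prop,
    (∀ x : ι → Bool, C x → ∃ P : DecisionTree ι β, P.depth ≤ d ∧
      ∀ y : ι → Bool, C y → (∀ i ∈ s, y i = x i) → P.eval y = g y) →
    ∃ P : DecisionTree ι β, P.depth ≤ s.card + d ∧ ∀ y, C y → P.eval y = g y := by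
  classical
  induction s using Finset.induction_on with
  | empty =>
    intro C hC
    by_cases hne : ∃ x, C x
    · obtain ⟨x, hx⟩ := hne
      obtain ⟨P, hP, h⟩ := hC x hx
      exact ⟨P, by simpa using hP, fun y hy => h y hy (by simp)⟩
    · exact ⟨leaf (g fun _ => false), by simp [depth], fun y hy => absurd ⟨y, hy⟩ hne⟩
  | insert a s ha ih =>
    intro C hC
    have step : ∀ b : Bool, ∃ P : DecisionTree ι β, P.depth ≤ s.card + d ∧
        ∀ y, (C y ∧ y a = b) → P.eval y = g y := by
      refine fun b => ih _ fun x hx => ?_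
      obtain ⟨P, hP, h⟩ := hC x hx.1
      refine ⟨P, hP, fun y hy hxy => h y hy.1 fun i hi => ?_⟩
      rcases Finset.mem_insert.1 hi with rfl | hi
      · rw [hy.2, hx.2]
      · exact hxy i hi
    obtain ⟨P, hP, hP'⟩ := step false
    obtain ⟨Q, hQ, hQ'⟩ := step true
    refine ⟨node a P Q, ?_, fun y hy => ?_⟩
    · rw [Finset.card_insert_of_notMem ha]; simp only [depth]; omega
    · simp only [eval]
      split_ifs with h
      · exact hQ' y ⟨hy, h⟩
      · exact hP' y ⟨hy, by simpa using h⟩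

/-- Read the variables in `s`, then those in a set that depends on the values read. -/
theorem exists_of_dependsOn {g : (ι → Bool) → β} (s : Finset ι) (s' : (ι → Bool) → Finset ι)
    {d : ℕ} (hd : ∀ x, (s' x).card ≤ d)
    (hg : ∀ x y z : ι → Bool, (∀ i ∈ s, y i = x i) → (∀ i ∈ s, z i = x i) →
      (∀ i ∈ s' x, y i = z i) → g y = g z) :
    ∃ P : DecisionTree ι β, P.depth ≤ s.card + d ∧ ∀ y, P.eval y = g y := by
  obtain ⟨P, hP, h⟩ := exists_of_read_on g s d (fun _ => True) fun x _ => by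
    obtain ⟨P, hP, h⟩ := exists_of_read_on g (s' x) 0 (fun y => ∀ i ∈ s, y i = x i)
      fun z hz => ⟨leaf (g z), le_rfl, fun y hy hyz => (hg x y z hy hz hyz).symm⟩
    exact ⟨P, hP.trans (hd x), fun y _ => h y⟩
  exact ⟨P, hP, fun y => h y trivial⟩

end DecisionTree

/-- The function `g` has query complexity at most `d`. -/
def Computes {ι β : Type*} (g : (ι → Bool) → β) (d : ℝ) : Prop :=
  ∃ P : DecisionTree ι β, (P.depth : ℝ) ≤ d ∧ ∀ x, P.eval x = g x

namespace Computes

variable {ι κ β γ : Type*}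

theorem mono {g : (ι → Bool) → β} {d d' : ℝ} (h : Computes g d) (hd : d ≤ d') :
    Computes g d' := by
  obtain ⟨P, hP, h⟩ := h
  exact ⟨P, hP.trans hd, h⟩

theorem const (v : β) {d : ℝ} (hd : 0 ≤ d) : Computes (fun _ : ι → Bool => v) d :=
  ⟨DecisionTree.leaf v, by simpa [DecisionTree.depth] using hd, fun _ => rfl⟩

theorem bind {f : (ι → Bool) → β} {g : β → (ι → Bool) → γ} {d d' : ℝ} (hf : Computes f d)
    (hg : ∀ v, Computes (g v) d') : Computes (fun x => g (f x) x) (d + d') := by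
  obtain ⟨P, hP, hPe⟩ := hf
  choose Q hQ hQe using hg
  have h0 : 0 ≤ d' := (Nat.cast_nonneg _).trans (hQ (f fun _ => false))
  refine ⟨P.bind Q, ?_, fun x => by rw [DecisionTree.eval_bind, hPe, hQe]⟩
  have h1 : (P.bind Q).depth ≤ P.depth + ⌊d'⌋₊ :=
    DecisionTree.depth_bind_le Q (fun v => Nat.le_floor (hQ v)) P
  have h2 : ((P.bind Q).depth : ℝ) ≤ P.depth + ⌊d'⌋₊ := by exact_mod_cast h1
  linarith [Nat.floor_le h0]

theorem comp {f : (ι → Bool) → β} {d : ℝ} (hf : Computes f d) (g : β → γ) :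
    Computes (fun x => g (f x)) d := by
  simpa using hf.bind (d' := 0) (g := fun v _ => g v) fun v => const (g v) le_rfl

theorem relabel {f : (ι → Bool) → β} {d : ℝ} (hf : Computes f d) (e : ι → κ) :
    Computes (fun x : κ → Bool => f fun i => x (e i)) d := by
  obtain ⟨P, hP, h⟩ := hf
  exact ⟨P.map e, by rwa [DecisionTree.depth_map], fun x => by rw [DecisionTree.eval_map, h]⟩

/-- Several functions are computed one after the other. -/
theorem table [DecidableEq κ] {f : κ → (ι → Bool) → β} {d : κ → ℝ} (b : β) (s : Finset κ)
    (hf : ∀ u ∈ s, Computes (f u) (d u)) :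
    Computes (fun x u => if u ∈ s then f u x else b) (∑ u ∈ s, d u) := by
  induction s using Finset.induction_on with
  | empty => simpa using const (ι := ι) (fun _ : κ => b) le_rfl
  | insert a s ha ih =>
    rw [Finset.sum_insert ha]
    have h := (hf a (by simp)).bind (g := fun v x u => if u = a then v else
      if u ∈ s then f u x else b) (d' := ∑ u ∈ s, d u) fun v =>
        (ih fun u hu => hf u (by simp [hu])).comp fun F u => if u = a then v else F u
    convert h using 3 with x u
    by_cases hu : u = a
    · simp [hu]
    · simp [hu]

end Computes

theorem queryComplexity_le {ι β : Type*} {g : (ι → Bool) → β} {d : ℝ} (h : Computes g d) :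
    (queryComplexity g : ℝ) ≤ d := by
  obtain ⟨P, hP, h⟩ := h
  have hle : queryComplexity g ≤ P.depth := Nat.sInf_le ⟨P, rfl, h⟩
  exact le_trans (by exact_mod_cast hle) hP

theorem exists_depth_eq_queryComplexity {ι β : Type*} [Fintype ι] (g : (ι → Bool) → β) :
    ∃ P : DecisionTree ι β, P.depth = queryComplexity g ∧ ∀ x, P.eval x = g x := by
  obtain ⟨P, hP⟩ := exists_decisionTree g
  have hne : {d : ℕ | ∃ P : DecisionTree ι β, P.depth = d ∧ ∀ x, P.eval x = g x}.Nonempty :=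
    ⟨P.depth, P, rfl, hP⟩
  exact Nat.sInf_mem hne

end Multitask

namespace Multitask

/-- The address bits of a bin with `M` keys: `s` bits for every point of `[c + 1]^M`. -/
abbrev AddressBit (M c s : ℕ) := (Fin M → Fin (c + 1)) × Fin s

/-- The cells of a bin: one for every ordered pair of keys and every assignment of the address
bits. -/
abbrev Cell (M c s : ℕ) := Fin M × Fin M × (AddressBit M c s → Bool)

/-- The bits of a bin. -/
abbrev BinBit (M c s : ℕ) := AddressBit M c s ⊕ Cell M c s

variable {M c s : ℕ}

/-- The part of the address bits that is seen by both of the keys `k` and `k'`: a key `k` sees the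
points whose `k`-th coordinate is `0`. -/
def mask (k k' : Fin M) (a : AddressBit M c s → Bool) : AddressBit M c s → Bool :=
  fun p => decide (p.1 k = 0 ∧ p.1 k' = 0) && a p

theorem mask_congr {k k' : Fin M} {a a' : AddressBit M c s → Bool}
    (h : ∀ p, p.1 k = 0 → p.1 k' = 0 → a p = a' p) : mask k k' a = mask k k' a' := by
  funext p
  by_cases hp : p.1 k = 0 ∧ p.1 k' = 0
  · simp [mask, hp, h p hp.1 hp.2]
  · simp [mask, hp]

/-- The bit that compares the key `k` with the key `k'`. -/
def duel (y : BinBit M c s → Bool) (k k' : Fin M) : Bool :=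
  y (.inr (k, k', mask k k' fun p => y (.inl p)))

/-- The key `k` wins against all other keys. -/
def Wins (y : BinBit M c s → Bool) (k : Fin M) : Prop :=
  ∀ k', k' ≠ k → duel y k k' = true ∧ duel y k' k = false

theorem Wins.unique {y : BinBit M c s → Bool} {k k' : Fin M} (h : Wins y k) (h' : Wins y k') :
    k = k' := by
  by_contra hne
  have h1 := (h k' (Ne.symm hne)).1
  have h2 := (h' k hne).2
  simp [h1] at h2

open Classical in
/-- The contents of the bin are the key that wins against all others. -/
noncomputable def winner (y : BinBit M c s → Bool) : Option (Fin M) :=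
  if h : ∃ k, Wins y k then some h.choose else none

theorem winner_eq_some {y : BinBit M c s → Bool} {k : Fin M} : winner y = some k ↔ Wins y k := by
  classical
  unfold winner
  split_ifs with h
  · rw [Option.some_inj]
    exact ⟨fun hk => hk ▸ h.choose_spec, fun hk => h.choose_spec.unique hk⟩
  · simp only [false_iff]
    exact fun hk => h ⟨k, hk⟩

theorem winner_eq_none {y : BinBit M c s → Bool} : winner y = none ↔ ∀ k, ¬ Wins y k := by
  rw [Option.eq_none_iff_forall_ne_some]
  exact forall_congr' fun k => not_congr winner_eq_some

open Classical in
/-- The values of the address bits that are consistent with the history `h`. -/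
noncomputable def consistent (h : List (BinBit M c s × Bool)) :
    Finset (AddressBit M c s → Bool) :=
  Finset.univ.filter fun a => ∀ p b, (.inl p, b) ∈ h → a p = b

/-- The values of the address bits under which a cell in `L` is used. -/
def hits (L : Finset (Cell M c s)) (a : AddressBit M c s → Bool) : Prop :=
  ∃ v ∈ L, mask v.1 v.2.1 a = v.2.2

open Classical in
/-- The address bits at the point `ω` that have been read. -/
noncomputable def readBits (h : List (BinBit M c s × Bool)) (ω : Fin M → Fin (c + 1)) :
    Finset (Fin s) :=
  Finset.univ.filter fun j => ∃ b, (.inl (ω, j), b) ∈ h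

theorem mem_consistent {h : List (BinBit M c s × Bool)} {a : AddressBit M c s → Bool} :
    a ∈ consistent h ↔ ∀ p b, (.inl p, b) ∈ h → a p = b := by
  simp [consistent]

theorem mem_readBits {h : List (BinBit M c s × Bool)} {ω : Fin M → Fin (c + 1)} {j : Fin s} :
    j ∈ readBits h ω ↔ ∃ b, (.inl (ω, j), b) ∈ h := by
  simp [readBits]

theorem readBits_mono {h h' : List (BinBit M c s × Bool)} (hh : h ⊆ h')
    (ω : Fin M → Fin (c + 1)) : readBits h ω ⊆ readBits h' ω := by
  intro j hj
  obtain ⟨b, hb⟩ := mem_readBits.1 hj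
  exact mem_readBits.2 ⟨b, hh hb⟩

theorem sum_card_readBits_le (h : List (BinBit M c s × Bool)) :
    ∑ ω, (readBits h ω).card ≤ h.length := by
  classical
  rw [← Finset.card_sigma]
  calc _ ≤ (h.toFinset.image Prod.fst).card := by
        refine Finset.card_le_card_of_injOn (fun p => .inl (p.1, p.2)) ?_ ?_
        · rintro ⟨ω, j⟩ hp
          simp only [Finset.coe_sigma, Set.mem_sigma_iff, Finset.mem_coe] at hp
          obtain ⟨b, hb⟩ := mem_readBits.1 hp.2
          simp only [Finset.coe_image, Set.mem_image, Finset.mem_coe, List.mem_toFinset]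
          exact ⟨_, hb, rfl⟩
        · rintro ⟨ω, j⟩ _ ⟨ω', j'⟩ _ heq
          simpa using heq
    _ ≤ h.toFinset.card := Finset.card_image_le
    _ ≤ h.length := h.toFinset_card_le

/-- If `F` is a set of unread address bits seen by `k` and `k'` then the fraction of the consistent
values of the address bits that use a given cell of `(k, k')` is at most `2 ^ (-|F|)`. -/
theorem card_use_cell_mul_le (h : List (BinBit M c s × Bool)) (k k' : Fin M)
    (α : AddressBit M c s → Bool) (F : Finset (AddressBit M c s))
    (hF : ∀ p ∈ F, p.1 k = 0 ∧ p.1 k' = 0) (hu : ∀ p ∈ F, ∀ b, (.inl p, b) ∉ h) :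
    ((consistent h).filter fun a => mask k k' a = α).card * 2 ^ F.card ≤ (consistent h).card := by
  classical
  rw [← Finset.card_powerset, ← Finset.card_product]
  refine Finset.card_le_card_of_injOn
    (fun q p => if p ∈ F then decide (p ∈ q.2) else q.1 p) ?_ ?_
  · rintro ⟨a, S⟩ hq
    simp only [Finset.coe_product, Set.mem_prod, Finset.mem_coe, Finset.mem_filter,
      Finset.mem_powerset] at hq
    rw [Finset.mem_coe, mem_consistent]
    intro p b hp
    simp only
    rw [if_neg fun hpF => hu p hpF b hp]
    exact mem_consistent.1 hq.1.1 p b hp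
  · rintro ⟨a, S⟩ hq ⟨a', S'⟩ hq' heq
    simp only [Finset.coe_product, Set.mem_prod, Finset.mem_coe, Finset.mem_filter,
      Finset.mem_powerset] at hq hq'
    have hval : ∀ p, (if p ∈ F then decide (p ∈ S) else a p) =
        if p ∈ F then decide (p ∈ S') else a' p := fun p => congrFun heq p
    refine Prod.ext (funext fun p => ?_) (Finset.ext fun p => ?_)
    · by_cases hp : p ∈ F
      · have h1 := congrFun (hq.1.2.trans hq'.1.2.symm) p
        simpa [mask, hF p hp] using h1
      · simpa [hp] using hval p
    · by_cases hp : p ∈ F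
      · simpa [hp] using hval p
      · exact ⟨fun h1 => absurd (hq.2 h1) hp, fun h1 => absurd (hq'.2 h1) hp⟩

/-- Among the points of a set that does not depend on the coordinates `k` and `k'`, a fraction of
at least `(c + 1) ^ (-2)` is seen by both of the keys `k` and `k'`. -/
theorem card_le_card_seen_mul (Z : Finset (Fin M → Fin (c + 1))) (k k' : Fin M)
    (hZ : ∀ ω ω' : Fin M → Fin (c + 1), (∀ i, i ≠ k → i ≠ k' → ω i = ω' i) →
      (ω ∈ Z ↔ ω' ∈ Z)) :
    Z.card ≤ (Z.filter fun ω => ω k = 0 ∧ ω k' = 0).card * (c + 1) ^ 2 := by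
  classical
  have : (c + 1) ^ 2 = (Finset.univ : Finset (Fin (c + 1) × Fin (c + 1))).card := by
    simp [sq]
  rw [this, ← Finset.card_product]
  refine Finset.card_le_card_of_injOn
    (fun ω => (fun i => if i = k ∨ i = k' then 0 else ω i, (ω k, ω k'))) ?_ ?_
  · intro ω hω
    simp only [Finset.coe_product, Set.mem_prod, Finset.mem_coe, Finset.mem_filter,
      Finset.mem_univ, and_true, true_or, or_true, if_true]
    refine (hZ _ _ fun i hi hi' => ?_).1 hω
    simp [hi, hi']
  · intro ω _ ω' _ heq
    simp only [Prod.mk.injEq] at heq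
    funext i
    by_cases hi : i = k
    · rw [hi, heq.2.1]
    by_cases hi' : i = k'
    · rw [hi', heq.2.2]
    simpa [hi, hi'] using congrFun heq.1 i

/-- The invariant kept up by the adversary. The cells in `L` were queried while their position
was still well hidden. The keys in `D` are given up, they come in at most `r` pairs. A point outside
`Z`, a set that depends on the coordinates in `D` only, has fewer than `t` unread bits. -/
structure BinState (t : ℕ) (h : List (BinBit M c s × Bool)) (L : Finset (Cell M c s))
    (D : Finset (Fin M)) (Z : Finset (Fin M → Fin (c + 1))) (r : ℕ) : Prop where
  card_cells : L.card ≤ h.length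
  nonempty : (consistent h).Nonempty
  card_hits : {a | a ∈ consistent h ∧ hits L a}.ncard * 2 ^ t ≤ L.card * (consistent h).card
  cell_unique : ∀ v, (.inr v, true) ∈ h → (.inr v, false) ∉ h
  loser : ∀ k k' α b, (.inr (k, k', α), b) ∈ h → (k, k', α) ∈ L ∨ (if b then k' else k) ∈ D
  card_dead : D.card ≤ 2 * r
  dependsOn : ∀ ω ω' : Fin M → Fin (c + 1), (∀ k ∈ D, ω k = ω' k) → (ω ∈ Z ↔ ω' ∈ Z)
  card_hidden : (Z.card : ℝ) ≤ (c + 1 : ℝ) ^ M * (1 - 1 / (c + 1 : ℝ) ^ 2) ^ r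
  exposed : ∀ ω, ω ∉ Z → s < (readBits h ω).card + t

theorem BinState.init (M c s t : ℕ) :
    BinState t ([] : List (BinBit M c s × Bool)) ∅ ∅ Finset.univ 0 where
  card_cells := by simp
  nonempty := ⟨fun _ => false, mem_consistent.2 (by simp)⟩
  card_hits := by simp [hits]
  cell_unique := by simp
  loser := by simp
  card_dead := by simp
  dependsOn := by simp
  card_hidden := by simp
  exposed := by simp

namespace BinState

variable {t : ℕ} {h : List (BinBit M c s × Bool)} {L : Finset (Cell M c s)}
  {D : Finset (Fin M)} {Z : Finset (Fin M → Fin (c + 1))} {r : ℕ}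

theorem exposed_cons (H : BinState t h L D Z r) (a : BinBit M c s × Bool) :
    ∀ ω, ω ∉ Z → s < (readBits (a :: h) ω).card + t := fun ω hω =>
  (H.exposed ω hω).trans_le
    (Nat.add_le_add_right (Finset.card_le_card (readBits_mono (List.subset_cons_self a h) ω)) t)

theorem consistent_cons_inr (v : Cell M c s) (b : Bool) :
    consistent ((.inr v, b) :: h) = consistent h := by
  ext a; simp [mem_consistent]

/-- Queries of address bits are answered so that the fraction of hits does not increase. -/
theorem step_address (H : BinState t h L D Z r) (p : AddressBit M c s) :
    ∃ b, BinState t ((.inl p, b) :: h) L D Z r := by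
  classical
  have hmem : ∀ b a, a ∈ consistent ((.inl p, b) :: h) ↔ a ∈ consistent h ∧ a p = b := by
    intro b a
    simp only [mem_consistent, List.mem_cons, Prod.mk.injEq, Sum.inl.injEq]
    constructor
    · exact fun ha => ⟨fun q b' hq => ha q b' (.inr hq), ha p b (.inl ⟨rfl, rfl⟩)⟩
    · rintro ⟨ha, hb⟩ q b' (⟨rfl, rfl⟩ | hq)
      exacts [hb, ha q b' hq]
  have hcons : ∀ b, consistent ((.inl p, b) :: h) = (consistent h).filter (fun a => a p = b) := by
    intro b; ext a; rw [hmem, Finset.mem_filter]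
  have hhit : ∀ h' : List (BinBit M c s × Bool), {a | a ∈ consistent h' ∧ hits L a}.ncard =
      ((consistent h').filter fun a => hits L a).card := by
    intro h'
    rw [← Set.ncard_coe_finset]
    congr 1; ext a; simp
  have key : ∃ b, (consistent ((.inl p, b) :: h)).Nonempty ∧
      {a | a ∈ consistent ((.inl p, b) :: h) ∧ hits L a}.ncard * 2 ^ t ≤
        L.card * (consistent ((.inl p, b) :: h)).card := by
    have hsum : ∀ X : Finset (AddressBit M c s → Bool),
        X.card = (X.filter fun a => a p = true).card + (X.filter fun a => a p = false).card := by
      intro X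
      rw [← Finset.card_filter_add_card_filter_not (s := X) fun a => a p = true]
      simp
    have h1 := H.card_hits
    rw [hhit, hsum (consistent h), hsum ((consistent h).filter _)] at h1
    have hswap : ∀ b, ((consistent h).filter fun a => hits L a).filter (fun a => a p = b) =
        ((consistent h).filter fun a => a p = b).filter fun a => hits L a := fun b =>
      Finset.filter_comm _ _ _
    rw [hswap, hswap, ← hcons, ← hcons, ← hhit, ← hhit] at h1
    have h0 := Finset.card_pos.2 H.nonempty
    rw [hsum, ← hcons, ← hcons] at h0
    by_contra! hcon
    have hb : ∀ b, (consistent ((.inl p, b) :: h)).card = 0 ∨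
        L.card * (consistent ((.inl p, b) :: h)).card <
          {a | a ∈ consistent ((.inl p, b) :: h) ∧ hits L a}.ncard * 2 ^ t := by
      intro b
      rcases Finset.eq_empty_or_nonempty (consistent ((.inl p, b) :: h)) with he | he
      · exact .inl (by rw [he]; rfl)
      · exact .inr (hcon b he)
    rcases hb true with ht | ht <;> rcases hb false with hf | hf
    · omega
    · rw [ht, zero_add] at h1
      exact absurd (hf.trans_le ((Nat.mul_le_mul_right _ (Nat.le_add_left _ _)).trans h1))
        (lt_irrefl _)
    · rw [hf, add_zero] at h1
      exact absurd (ht.trans_le ((Nat.mul_le_mul_right _ (Nat.le_add_right _ _)).trans h1))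
        (lt_irrefl _)
    · nlinarith
  obtain ⟨b, hb1, hb2⟩ := key
  exact ⟨b, {
    card_cells := by rw [List.length_cons]; exact H.card_cells.trans (Nat.le_succ _)
    nonempty := hb1
    card_hits := hb2
    cell_unique := by simpa using H.cell_unique
    loser := by simpa using H.loser
    card_dead := H.card_dead
    dependsOn := H.dependsOn
    card_hidden := H.card_hidden
    exposed := H.exposed_cons _ }⟩

/-- A repeated query of a cell gets the same answer. -/
theorem step_repeat (H : BinState t h L D Z r) {v : Cell M c s} {b : Bool}
    (hv : (.inr v, b) ∈ h) : BinState t ((.inr v, b) :: h) L D Z r where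
  card_cells := by rw [List.length_cons]; exact H.card_cells.trans (Nat.le_succ _)
  nonempty := by rw [consistent_cons_inr]; exact H.nonempty
  card_hits := by rw [consistent_cons_inr]; exact H.card_hits
  cell_unique := by
    have hm : ∀ x, x ∈ (Sum.inr v, b) :: h ↔ x ∈ h := fun x =>
      ⟨fun hx => (List.mem_cons.1 hx).elim (fun hx => hx ▸ hv) id, List.mem_cons_of_mem _⟩
    simpa only [hm] using H.cell_unique
  loser := by
    have hm : ∀ x, x ∈ (Sum.inr v, b) :: h ↔ x ∈ h := fun x =>
      ⟨fun hx => (List.mem_cons.1 hx).elim (fun hx => hx ▸ hv) id, List.mem_cons_of_mem _⟩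
    simpa only [hm] using H.loser
  card_dead := H.card_dead
  dependsOn := H.dependsOn
  card_hidden := H.card_hidden
  exposed := H.exposed_cons _

theorem cell_unique_cons (H : BinState t h L D Z r) {v : Cell M c s}
    (hv : ∀ b, (.inr v, b) ∉ h) (b : Bool) :
    ∀ v', (.inr v', true) ∈ (Sum.inr v, b) :: h → (.inr v', false) ∉ (Sum.inr v, b) :: h := by
  intro v' h1 h2
  simp only [List.mem_cons, Prod.mk.injEq, Sum.inr.injEq] at h1 h2
  rcases h1 with ⟨rfl, h1⟩ | h1
  · rcases h2 with ⟨-, h2⟩ | h2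
    · simp [← h1] at h2
    · exact hv _ h2
  · rcases h2 with ⟨rfl, h2⟩ | h2
    · exact hv _ h1
    · exact H.cell_unique v' h1 h2

/-- A cell of two keys one of which is given up is answered in favour of the other one. -/
theorem step_dead (H : BinState t h L D Z r) {k k' : Fin M} {α : AddressBit M c s → Bool}
    (hv : ∀ b, (.inr (k, k', α), b) ∉ h) {b : Bool} (hD : (if b then k' else k) ∈ D) :
    BinState t ((.inr (k, k', α), b) :: h) L D Z r where
  card_cells := by rw [List.length_cons]; exact H.card_cells.trans (Nat.le_succ _)
  nonempty := by rw [consistent_cons_inr]; exact H.nonempty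
  card_hits := by rw [consistent_cons_inr]; exact H.card_hits
  cell_unique := H.cell_unique_cons hv b
  loser := by
    intro i i' β b' hm
    rcases List.mem_cons.1 hm with hm | hm
    · simp only [Prod.mk.injEq, Sum.inr.injEq] at hm
      obtain ⟨⟨rfl, rfl, rfl⟩, rfl⟩ := hm
      exact .inr hD
    · exact H.loser _ _ _ _ hm
  card_dead := H.card_dead
  dependsOn := H.dependsOn
  card_hidden := H.card_hidden
  exposed := H.exposed_cons _

/-- A cell whose position is well hidden gets an arbitrary answer. -/
theorem step_hidden [DecidableEq (Cell M c s)] (H : BinState t h L D Z r) {k k' : Fin M}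
    {α : AddressBit M c s → Bool} (hv : ∀ b, (.inr (k, k', α), b) ∉ h)
    {ω : Fin M → Fin (c + 1)} (hk : ω k = 0) (hk' : ω k' = 0)
    (hω : (readBits h ω).card + t ≤ s) (b : Bool) :
    BinState t ((.inr (k, k', α), b) :: h) (insert (k, k', α) L) D Z r where
  card_cells := by
    rw [List.length_cons]
    exact (Finset.card_insert_le _ _).trans (Nat.succ_le_succ H.card_cells)
  nonempty := by rw [consistent_cons_inr]; exact H.nonempty
  card_hits := by
    classical
    rw [consistent_cons_inr]
    by_cases hL : (k, k', α) ∈ L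
    · rw [Finset.insert_eq_of_mem hL]; exact H.card_hits
    rw [Finset.card_insert_of_notMem hL]
    let F : Finset (AddressBit M c s) := (readBits h ω)ᶜ.image fun j => (ω, j)
    have hFcard : F.card = s - (readBits h ω).card := by
      rw [Finset.card_image_of_injective _ (Prod.mk_right_injective ω), Finset.card_compl,
        Fintype.card_fin]
    have hF := card_use_cell_mul_le h k k' α F
      (fun p hp => by
        obtain ⟨j, -, rfl⟩ := Finset.mem_image.1 hp
        exact ⟨hk, hk'⟩)
      (fun p hp b hb => by
        obtain ⟨j, hj, rfl⟩ := Finset.mem_image.1 hp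
        exact Finset.mem_compl.1 hj (mem_readBits.2 ⟨b, hb⟩))
    have ht : 2 ^ t ≤ 2 ^ F.card := Nat.pow_le_pow_right (by norm_num) (by omega)
    have hsub : {a | a ∈ consistent h ∧ hits (insert (k, k', α) L) a} ⊆
        {a | a ∈ consistent h ∧ hits L a} ∪
          (((consistent h).filter fun a => mask k k' a = α : Finset _) : Set _) := by
      rintro a ⟨ha, v, hvL, hva⟩
      rcases Finset.mem_insert.1 hvL with rfl | hvL
      · exact .inr (by simpa using ⟨ha, hva⟩)
      · exact .inl ⟨ha, v, hvL, hva⟩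
    have hcard := (Set.ncard_le_ncard hsub (Set.toFinite _)).trans (Set.ncard_union_le _ _)
    rw [Set.ncard_coe_finset] at hcard
    have h2 := H.card_hits
    calc _ ≤ ({a | a ∈ consistent h ∧ hits L a}.ncard +
            ((consistent h).filter fun a => mask k k' a = α).card) * 2 ^ t :=
          Nat.mul_le_mul_right _ hcard
      _ = {a | a ∈ consistent h ∧ hits L a}.ncard * 2 ^ t +
            ((consistent h).filter fun a => mask k k' a = α).card * 2 ^ t := by ring
      _ ≤ L.card * (consistent h).card + (consistent h).card :=
          Nat.add_le_add h2 ((Nat.mul_le_mul_left _ ht).trans hF)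
      _ = _ := by ring
  cell_unique := H.cell_unique_cons hv b
  loser := by
    intro i i' β b' hm
    rcases List.mem_cons.1 hm with hm | hm
    · simp only [Prod.mk.injEq, Sum.inr.injEq] at hm
      obtain ⟨⟨rfl, rfl, rfl⟩, rfl⟩ := hm
      exact .inl (Finset.mem_insert_self _ _)
    · exact (H.loser _ _ _ _ hm).imp_left (Finset.mem_insert_of_mem)
  card_dead := H.card_dead
  dependsOn := H.dependsOn
  card_hidden := H.card_hidden
  exposed := H.exposed_cons _

/-- Two keys all of whose common points are exposed may be given up. -/
theorem give_up (H : BinState t h L D Z r) {k k' : Fin M} (hk : k ∉ D) (hk' : k' ∉ D)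
    (hexp : ∀ ω : Fin M → Fin (c + 1), ω k = 0 → ω k' = 0 → s < (readBits h ω).card + t) :
    BinState t h L (insert k (insert k' D)) (Z.filter fun ω => ¬ (ω k = 0 ∧ ω k' = 0))
      (r + 1) where
  card_cells := H.card_cells
  nonempty := H.nonempty
  card_hits := H.card_hits
  cell_unique := H.cell_unique
  loser := fun i i' β b hm => (H.loser i i' β b hm).imp_right fun hD => by simp [hD]
  card_dead := by
    have h1 := Finset.card_insert_le k (insert k' D)
    have h2 := Finset.card_insert_le k' D
    have h3 := H.card_dead
    omega
  dependsOn := by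
    intro ω ω' hω
    rw [Finset.mem_filter, Finset.mem_filter, hω k (by simp), hω k' (by simp),
      H.dependsOn ω ω' fun i hi => hω i (by simp [hi])]
  card_hidden := by
    have h1 := card_le_card_seen_mul Z k k' fun ω ω' hω =>
      H.dependsOn ω ω' fun i hi => hω i (fun h => hk (h ▸ hi)) (fun h => hk' (h ▸ hi))
    have h2 := Finset.card_filter_add_card_filter_not (s := Z) fun ω => ω k = 0 ∧ ω k' = 0
    have h1' : (Z.card : ℝ) ≤ ((Z.filter fun ω => ω k = 0 ∧ ω k' = 0).card : ℝ) *
        (c + 1 : ℝ) ^ 2 := by exact_mod_cast h1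
    have h2' : ((Z.filter fun ω => ω k = 0 ∧ ω k' = 0).card : ℝ) +
        ((Z.filter fun ω => ¬ (ω k = 0 ∧ ω k' = 0)).card : ℝ) = Z.card := by exact_mod_cast h2
    have hc : (0 : ℝ) < (c + 1 : ℝ) ^ 2 := by positivity
    have h3 : (Z.card : ℝ) / (c + 1 : ℝ) ^ 2 ≤ (Z.filter fun ω => ω k = 0 ∧ ω k' = 0).card :=
      (div_le_iff₀ hc).2 h1'
    have hρ : (0 : ℝ) ≤ 1 - 1 / (c + 1 : ℝ) ^ 2 := by
      rw [sub_nonneg, div_le_one hc]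
      exact one_le_pow₀ (by linarith [Nat.cast_nonneg (α := ℝ) c])
    calc _ ≤ (Z.card : ℝ) * (1 - 1 / (c + 1 : ℝ) ^ 2) := by
          rw [mul_sub, mul_one, mul_one_div]; linarith
      _ ≤ _ := by
          rw [pow_succ _ r, ← mul_assoc]
          exact mul_le_mul_of_nonneg_right H.card_hidden hρ
  exposed := by
    intro ω hω
    by_cases hZ : ω ∈ Z
    · have : ω k = 0 ∧ ω k' = 0 := by
        by_contra hcon
        exact hω (Finset.mem_filter.2 ⟨hZ, hcon⟩)
      exact hexp ω this.1 this.2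
    · exact H.exposed ω hZ

/-- The invariant can be kept up whatever bit is queried. -/
theorem step (H : BinState t h L D Z r) (i : BinBit M c s) :
    ∃ b L D Z r, BinState t ((i, b) :: h) L D Z r := by
  classical
  rcases i with p | ⟨k, k', α⟩
  · obtain ⟨b, hb⟩ := H.step_address p
    exact ⟨b, _, _, _, _, hb⟩
  by_cases hv : ∃ b, (.inr (k, k', α), b) ∈ h
  · obtain ⟨b, hb⟩ := hv
    exact ⟨b, _, _, _, _, H.step_repeat hb⟩
  rw [not_exists] at hv
  by_cases hk : k ∈ D
  · exact ⟨false, _, _, _, _, H.step_dead hv (by simpa using hk)⟩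
  by_cases hk' : k' ∈ D
  · exact ⟨true, _, _, _, _, H.step_dead hv (by simpa using hk')⟩
  by_cases hω : ∃ ω : Fin M → Fin (c + 1), ω k = 0 ∧ ω k' = 0 ∧ (readBits h ω).card + t ≤ s
  · obtain ⟨ω, h1, h2, h3⟩ := hω
    exact ⟨true, _, _, _, _, H.step_hidden hv h1 h2 h3 true⟩
  · push Not at hω
    exact ⟨true, _, _, _, _, (H.give_up hk hk' hω).step_dead hv (by simp)⟩

theorem le_length (H : BinState t h L D Z r) :
    ((c + 1 : ℝ) ^ M - Z.card) * (s - t) ≤ h.length := by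
  classical
  have h1 : (Zᶜ.card : ℝ) = (c + 1 : ℝ) ^ M - Z.card := by
    have := Finset.card_add_card_compl Z
    rw [Fintype.card_fun, Fintype.card_fin, Fintype.card_fin] at this
    rw [eq_sub_iff_add_eq', ← Nat.cast_add, this]
    push_cast; rfl
  calc _ = ∑ _ω ∈ Zᶜ, ((s : ℝ) - t) := by rw [Finset.sum_const, nsmul_eq_mul, h1]
    _ ≤ ∑ ω ∈ Zᶜ, ((readBits h ω).card : ℝ) := by
        refine Finset.sum_le_sum fun ω hω => ?_
        have := H.exposed ω (Finset.mem_compl.1 hω)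
        rw [sub_le_iff_le_add]
        exact_mod_cast this.le
    _ ≤ ∑ ω, ((readBits h ω).card : ℝ) :=
        Finset.sum_le_sum_of_subset_of_nonneg (Finset.subset_univ _) fun _ _ _ => by positivity
    _ ≤ _ := by exact_mod_cast sum_card_readBits_le h

/-- As long as few bits are read, there is a value of the address bits that is consistent with the
history and misses the cells that were queried early. -/
theorem exists_not_hits (H : BinState t h L D Z r) (hlen : h.length < 2 ^ t) :
    ∃ a ∈ consistent h, ¬ hits L a := by
  by_contra! hcon
  have h1 : {a | a ∈ consistent h ∧ hits L a} = (consistent h : Set _) := by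
    ext a; simpa using hcon a
  have h2 := H.card_hits
  rw [h1, Set.ncard_coe_finset, mul_comm] at h2
  have h3 := Nat.le_of_mul_le_mul_right h2 (Finset.card_pos.2 H.nonempty)
  have := H.card_cells
  omega

end BinState

open Classical in
/-- The input with address bits `a` and the cells as in the history `h`; the cells that have not
been queried are filled by `v`. -/
noncomputable def fill (h : List (BinBit M c s × Bool)) (a : AddressBit M c s → Bool)
    (v : Fin M → Fin M → Bool) : BinBit M c s → Bool
  | .inl p => a p
  | .inr x => if (.inr x, true) ∈ h then true else if (.inr x, false) ∈ h then false
      else v x.1 x.2.1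

namespace BinState

variable {t : ℕ} {h : List (BinBit M c s × Bool)} {L : Finset (Cell M c s)}
  {D : Finset (Fin M)} {Z : Finset (Fin M → Fin (c + 1))} {r : ℕ}

theorem fill_agrees (H : BinState t h L D Z r) {a : AddressBit M c s → Bool}
    (ha : a ∈ consistent h) (v : Fin M → Fin M → Bool) :
    ∀ x ∈ h, fill h a v x.1 = x.2 := by
  rintro ⟨p | x, b⟩ hx
  · exact mem_consistent.1 ha p b hx
  · cases b
    · have : (Sum.inr x, true) ∉ h := fun h' => H.cell_unique x h' hx
      simp [fill, hx, this]
    · simp [fill, hx]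

/-- A queried cell that is used was answered against a key that is given up. -/
theorem duel_fill (H : BinState t h L D Z r) {a : AddressBit M c s → Bool}
    (hL : ¬ hits L a) (v : Fin M → Fin M → Bool) (k k' : Fin M) :
    duel (fill h a v) k k' = v k k' ∨ (if duel (fill h a v) k k' then k' else k) ∈ D := by
  have hnot : (k, k', mask k k' a) ∉ L := fun hm => hL ⟨_, hm, rfl⟩
  have hd : duel (fill h a v) k k' = fill h a v (.inr (k, k', mask k k' a)) := rfl
  rw [hd]
  by_cases h1 : (.inr (k, k', mask k k' a), true) ∈ h
  · refine .inr ?_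
    simpa [fill, h1] using (H.loser _ _ _ _ h1).resolve_left hnot
  by_cases h2 : (.inr (k, k', mask k k' a), false) ∈ h
  · refine .inr ?_
    simpa [fill, h1, h2] using (H.loser _ _ _ _ h2).resolve_left hnot
  · exact .inl (by simp [fill, h1, h2])

theorem exists_winner (H : BinState t h L D Z r) (hlen : h.length < 2 ^ t) {k : Fin M}
    (hk : k ∉ D) : ∃ y : BinBit M c s → Bool, (∀ x ∈ h, y x.1 = x.2) ∧ winner y = some k := by
  classical
  obtain ⟨a, ha, hL⟩ := H.exists_not_hits hlen
  refine ⟨fill h a fun i _ => decide (i = k), H.fill_agrees ha _, winner_eq_some.2 fun k' hk' => ?_⟩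
  constructor
  · rcases H.duel_fill hL (fun i _ => decide (i = k)) k k' with h1 | h1
    · simpa using h1
    · by_contra hcon; rw [if_neg hcon] at h1; exact hk h1
  · rcases H.duel_fill hL (fun i _ => decide (i = k)) k' k with h1 | h1
    · simpa [hk'] using h1
    · by_contra hcon
      rw [Bool.not_eq_false] at hcon
      rw [if_pos hcon] at h1; exact hk h1

theorem exists_no_winner (H : BinState t h L D Z r) (hlen : h.length < 2 ^ t)
    (hD : D.card + 2 ≤ M) :
    ∃ y : BinBit M c s → Bool, (∀ x ∈ h, y x.1 = x.2) ∧ winner y = none := by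
  classical
  obtain ⟨a, ha, hL⟩ := H.exists_not_hits hlen
  refine ⟨fill h a fun _ _ => true, H.fill_agrees ha _, winner_eq_none.2 fun k hk => ?_⟩
  obtain ⟨k', hk'⟩ : ((insert k D)ᶜ).Nonempty := by
    rw [← Finset.card_pos, Finset.card_compl, Fintype.card_fin]
    have := Finset.card_insert_le k D
    omega
  simp only [Finset.mem_compl, Finset.mem_insert, not_or] at hk'
  have h2 := (hk k' hk'.1).2
  rcases H.duel_fill hL (fun _ _ => true) k' k with h1 | h1
  · rw [h1] at h2; simp at h2
  · rw [h2] at h1; exact hk'.2 h1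

end BinState

end Multitask

namespace Multitask

/-- Some adversary can answer up to `q` queries such that all but a fraction `δ` of the keys
are consistent with the answers and it is consistent that the bin is empty. The adversary is
given by the set of the histories that it allows. -/
def BinFunction.Fools {m M : ℕ} (B : BinFunction m M) (q δ : ℝ) : Prop :=
  ∃ Good : List (Fin m × Bool) → Prop, Good [] ∧
    (∀ h i, Good h → ∃ b, Good ((i, b) :: h)) ∧
    ∀ h, Good h → (h.length : ℝ) ≤ q →
      (∃ D : Finset (Fin M), (D.card : ℝ) ≤ δ * M ∧
        ∀ k, k ∉ D → ∃ y : Fin m → Bool, (∀ a ∈ h, y a.1 = a.2) ∧ B y = some k) ∧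
      ∃ y : Fin m → Bool, (∀ a ∈ h, y a.1 = a.2) ∧ B y = none

theorem BinFunction.Fools.mono {m M : ℕ} {B : BinFunction m M} {q q' δ δ' : ℝ}
    (h : B.Fools q δ) (hq : q' ≤ q) (hδ : δ ≤ δ') : B.Fools q' δ' := by
  obtain ⟨Good, h0, hs, h⟩ := h
  refine ⟨Good, h0, hs, fun l hl hlen => ?_⟩
  obtain ⟨⟨D, hD, h1⟩, h2⟩ := h l hl (hlen.trans hq)
  exact ⟨⟨D, hD.trans (by gcongr), h1⟩, h2⟩

theorem BinFunction.Fools.secure {m M : ℕ} {B : BinFunction m M} {q δ : ℝ} (hq : 0 ≤ q)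
    (h : B.Fools q δ) : B.Secure ⌊q⌋₊ (1 - δ) := by
  classical
  obtain ⟨Good, h0, hs, h⟩ := h
  obtain ⟨σ, hσ⟩ := DecisionTree.exists_adversary hs
  refine ⟨σ, fun P hP => ?_⟩
  have hlen : ((P.transcript σ []).length : ℝ) ≤ q := by
    have h1 := (DecisionTree.length_transcript_le σ P []).trans
      (Nat.add_le_add_right hP _)
    rw [List.length_nil, add_zero] at h1
    exact le_trans (by exact_mod_cast h1) (Nat.floor_le hq)
  obtain ⟨⟨D, hD, h1⟩, -⟩ := h _ (DecisionTree.transcript_induction hσ P [] h0) hlen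
  refine ⟨Dᶜ, ?_, fun k hk => h1 k (Finset.mem_compl.1 hk)⟩
  rw [Finset.card_compl, Fintype.card_fin, Nat.cast_sub (by simpa using D.card_le_univ)]
  linarith

variable {M c s : ℕ}

theorem mask_eq_of_agree {k k' : Fin M} {x y : BinBit M c s → Bool}
    (h : ∀ p : AddressBit M c s, p.1 k = 0 → p.1 k' = 0 → y (.inl p) = x (.inl p)) :
    mask k k' (fun p => y (.inl p)) = mask k k' fun p => x (.inl p) :=
  mask_congr h

theorem computes_winner (M c s : ℕ) :
    Computes (winner : (BinBit M c s → Bool) → Option (Fin M))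
      ((c + 1 : ℝ) ^ M * s + (M : ℝ) ^ 2) := by
  classical
  obtain ⟨P, hP, h⟩ := DecisionTree.exists_of_dependsOn
    (g := (winner : (BinBit M c s → Bool) → Option (Fin M)))
    (Finset.univ.image Sum.inl)
    (fun x => (Finset.univ : Finset (Fin M × Fin M)).image fun q =>
      .inr (q.1, q.2, mask q.1 q.2 fun p => x (.inl p)))
    (d := M ^ 2) (fun x => Finset.card_image_le.trans (by simp [sq])) (by
      intro x y z hy hz hyz
      have hd : ∀ k k', duel y k k' = duel z k k' := by
        intro k k'
        unfold duel
        rw [mask_eq_of_agree fun p _ _ => hy (.inl p) (by simp),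
          mask_eq_of_agree fun p _ _ => hz (.inl p) (by simp)]
        exact hyz _ (Finset.mem_image.2 ⟨(k, k'), by simp, rfl⟩)
      have hw : Wins y = Wins z := funext fun k => by simp only [Wins, hd]
      unfold winner
      rw [hw])
  refine ⟨P, ?_, h⟩
  rw [Finset.card_image_of_injective _ Sum.inl_injective] at hP
  have : (Finset.univ : Finset (AddressBit M c s)).card = (c + 1) ^ M * s := by simp
  rw [this] at hP
  exact_mod_cast hP

theorem card_seen_mul_le (M c s : ℕ) (k : Fin M) :
    ((Finset.univ : Finset (AddressBit M c s)).filter fun p => p.1 k = 0).card * (c + 1) ≤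
      (c + 1) ^ M * s := by
  classical
  have h1 : (Finset.univ : Finset (AddressBit M c s)).card = (c + 1) ^ M * s := by simp
  have h2 : (Finset.univ : Finset (Fin (c + 1))).card = c + 1 := by simp
  refine le_of_eq_of_le (b := ((Finset.univ.filter fun p : AddressBit M c s => p.1 k = 0) ×ˢ
    (Finset.univ : Finset (Fin (c + 1)))).card) (by rw [Finset.card_product, h2]) ?_
  rw [← h1]
  refine Finset.card_le_card_of_injOn (fun q => (Function.update q.1.1 k q.2, q.1.2))
    (fun _ _ => by simp) ?_
  rintro ⟨⟨ω, j⟩, i⟩ hq ⟨⟨ω', j'⟩, i'⟩ hq' heq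
  simp only [Finset.coe_product, Finset.coe_filter, Finset.mem_univ, true_and, Set.mem_prod,
    Set.mem_ofPred_eq, Finset.coe_univ, Set.mem_univ, and_true] at hq hq'
  simp only [Prod.mk.injEq] at heq ⊢
  refine ⟨⟨funext fun l => ?_, heq.2⟩, by simpa using congrFun heq.1 k⟩
  by_cases hl : l = k
  · rw [hl, hq, hq']
  · simpa [hl] using congrFun heq.1 l

theorem computes_winner_eq (M c s : ℕ) (k : Fin M) :
    Computes (fun y : BinBit M c s → Bool => decide (winner y = some k))
      ((c + 1 : ℝ) ^ M * s / (c + 1) + 2 * M) := by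
  classical
  obtain ⟨P, hP, h⟩ := DecisionTree.exists_of_dependsOn
    (g := fun y : BinBit M c s → Bool => decide (winner y = some k))
    ((Finset.univ.filter fun p : AddressBit M c s => p.1 k = 0).image Sum.inl)
    (fun x => ((Finset.univ : Finset (Fin M)).image fun k' =>
        .inr (k, k', mask k k' fun p => x (.inl p))) ∪
      ((Finset.univ : Finset (Fin M)).image fun k' =>
        .inr (k', k, mask k' k fun p => x (.inl p))))
    (d := 2 * M) (fun x => by
      refine (Finset.card_union_le _ _).trans ?_
      rw [two_mul]
      exact Nat.add_le_add (Finset.card_image_le.trans (by simp))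
        (Finset.card_image_le.trans (by simp))) (by
      intro x y z hy hz hyz
      have hd : ∀ k', duel y k k' = duel z k k' := by
        intro k'
        unfold duel
        rw [mask_eq_of_agree fun p hp _ => hy (.inl p) (by simpa using hp),
          mask_eq_of_agree fun p hp _ => hz (.inl p) (by simpa using hp)]
        exact hyz _ (Finset.mem_union_left _ (Finset.mem_image.2 ⟨k', by simp, rfl⟩))
      have hd' : ∀ k', duel y k' k = duel z k' k := by
        intro k'
        unfold duel
        rw [mask_eq_of_agree fun p _ hp => hy (.inl p) (by simpa using hp),
          mask_eq_of_agree fun p _ hp => hz (.inl p) (by simpa using hp)]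
        exact hyz _ (Finset.mem_union_right _ (Finset.mem_image.2 ⟨k', by simp, rfl⟩))
      simp only [winner_eq_some, Wins, hd, hd'])
  refine ⟨P, ?_, h⟩
  rw [Finset.card_image_of_injective _ Sum.inl_injective] at hP
  have h1 : (((Finset.univ : Finset (AddressBit M c s)).filter fun p => p.1 k = 0).card : ℝ) ≤
      (c + 1 : ℝ) ^ M * s / (c + 1) := by
    rw [le_div_iff₀ (by positivity)]
    exact_mod_cast card_seen_mul_le M c s k
  have h2 : (P.depth : ℝ) ≤
      ((Finset.univ : Finset (AddressBit M c s)).filter fun p => p.1 k = 0).card + 2 * M := by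
    exact_mod_cast hP
  linarith

/-- The bin function given by `winner` for some numbering of the bits. -/
noncomputable def winnerBin (M c s : ℕ) :
    BinFunction (Fintype.card (BinBit M c s)) M :=
  fun y => winner fun x => y (Fintype.equivFin _ x)

theorem fools_winnerBin {t : ℕ} {q δ : ℝ} (hq : q < 2 ^ t)
    (hD : ∀ h : List (BinBit M c s × Bool), ∀ L D Z r, BinState t h L D Z r →
      (h.length : ℝ) ≤ q → (D.card : ℝ) ≤ δ * M) (hM : δ * M + 2 ≤ M) :
    (winnerBin M c s).Fools q δ := by
  let e := Fintype.equivFin (BinBit M c s)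
  refine ⟨fun h => ∃ L D Z r, BinState t (h.map fun a => (e.symm a.1, a.2)) L D Z r,
    ⟨_, _, _, _, BinState.init M c s t⟩, ?_, ?_⟩
  · rintro h i ⟨L, D, Z, r, H⟩
    exact H.step (e.symm i)
  · rintro h ⟨L, D, Z, r, H⟩ hlen
    have hlen' : ((h.map fun a => (e.symm a.1, a.2)).length : ℝ) ≤ q := by simpa using hlen
    have hlt : (h.map fun a => (e.symm a.1, a.2)).length < 2 ^ t := by
      exact_mod_cast hlen'.trans_lt hq
    have hD := hD _ _ _ _ _ H hlen'
    have transfer : ∀ v, (∃ y : BinBit M c s → Bool,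
        (∀ x ∈ h.map fun a => (e.symm a.1, a.2), y x.1 = x.2) ∧ winner y = v) →
        ∃ y : Fin (Fintype.card (BinBit M c s)) → Bool,
          (∀ a ∈ h, y a.1 = a.2) ∧ winnerBin M c s y = v := by
      rintro v ⟨y, hy, hv⟩
      refine ⟨fun i => y (e.symm i), fun a ha => hy _ (List.mem_map_of_mem ha), ?_⟩
      simpa [winnerBin, e] using hv
    refine ⟨⟨D, hD, fun k hk => transfer _ (H.exists_winner hlt hk)⟩,
      transfer _ (H.exists_no_winner hlt ?_)⟩
    exact_mod_cast (add_le_add_left hD 2).trans hM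

theorem exists_parameters (C W E : ℝ) {K : ℝ} (hK : 0 < K) :
    ∃ t : ℕ, 0 < t ∧ C ≤ K * t ∧ W * (K * t + E) < 2 ^ t := by
  have h1 : Filter.Tendsto (fun t : ℕ => K * (t : ℝ)) Filter.atTop Filter.atTop :=
    tendsto_natCast_atTop_atTop.const_mul_atTop hK
  have h2 : Filter.Tendsto (fun t : ℕ => (t : ℝ) / 2 ^ t) Filter.atTop (nhds 0) := by
    simpa using tendsto_pow_const_div_const_pow_of_one_lt 1 (one_lt_two (α := ℝ))
  have h3 : Filter.Tendsto (fun t : ℕ => 1 / (2 : ℝ) ^ t) Filter.atTop (nhds 0) := by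
    simpa using tendsto_pow_const_div_const_pow_of_one_lt 0 (one_lt_two (α := ℝ))
  have h4 : Filter.Tendsto (fun t : ℕ => W * (K * ((t : ℝ) / 2 ^ t) + E * (1 / (2 : ℝ) ^ t)))
      Filter.atTop (nhds 0) := by
    simpa using ((h2.const_mul K).add (h3.const_mul E)).const_mul W
  obtain ⟨t, ht1, ht2, ht3⟩ := ((Filter.eventually_gt_atTop 0).and
    ((h1.eventually_ge_atTop C).and (h4.eventually_lt_const zero_lt_one))).exists
  refine ⟨t, ht1, ht2, ?_⟩
  have hp : (0 : ℝ) < 2 ^ t := by positivity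
  have : W * (K * ((t : ℝ) / 2 ^ t) + E * (1 / (2 : ℝ) ^ t)) = W * (K * t + E) / 2 ^ t := by
    field_simp
  rwa [this, div_lt_one hp] at ht3

/-- The number of keys that are given up is small. -/
theorem card_dead_le {t w K r₀ : ℕ} {δ : ℝ} (hδ : 0 < δ) (hδ1 : δ < 1) (hw : 0 < w) (ht : 0 < t)
    (hK : 8 ≤ δ * K)
    (hM : 4 * (M : ℝ) ^ 2 ≤ δ * ((c + 1 : ℝ) ^ M * (K * t)))
    (hr₀ : (1 - 1 / (c + 1 : ℝ) ^ 2) ^ r₀ < δ / 2) (hr₀M : 2 * (r₀ : ℝ) ≤ δ * M)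
    {h : List (BinBit M c (w * (K * t)) × Bool)} {L : Finset (Cell M c (w * (K * t)))}
    {D : Finset (Fin M)} {Z : Finset (Fin M → Fin (c + 1))} {r : ℕ}
    (H : BinState t h L D Z r)
    (hlen : (h.length : ℝ) ≤ (1 - δ) * (w * ((c + 1 : ℝ) ^ M * (K * t) + (M : ℝ) ^ 2))) :
    (D.card : ℝ) ≤ δ * M := by
  have hw1 : (1 : ℝ) ≤ w := by exact_mod_cast hw
  have ht1 : (1 : ℝ) ≤ t := by exact_mod_cast ht
  have hK0 : (0 : ℝ) ≤ K := Nat.cast_nonneg K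
  have hlow := H.le_length
  set N : ℝ := (c + 1 : ℝ) ^ M with hN
  have hN0 : 0 < N := by positivity
  set S : ℝ := w * (K * t) with hS
  have hcast : ((w * (K * t) : ℕ) : ℝ) = S := by push_cast; rfl
  rw [hcast] at hlow
  have hts : (t : ℝ) ≤ δ / 8 * S := by
    have h1 : 8 * (t : ℝ) ≤ δ * K * t := by nlinarith
    have h2 : δ * K * t ≤ w * (δ * K * t) := le_mul_of_one_le_left (by positivity) hw1
    have h3 : w * (δ * K * t) = δ * S := by rw [hS]; ring
    linarith
  have hMS : w * (M : ℝ) ^ 2 ≤ δ / 4 * (N * S) := by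
    have h1 := mul_le_mul_of_nonneg_left hM (zero_le_one.trans hw1)
    have h2 : (w : ℝ) * (δ * (N * (K * t))) = δ * (N * S) := by rw [hS]; ring
    linarith
  have hS0 : 0 < S := by nlinarith
  have hNS : 0 < N * S := mul_pos hN0 hS0
  have hZ : δ / 2 * N ≤ Z.card := by
    by_contra! hcon
    have h1 : (1 - δ / 2) * N * ((1 - δ / 8) * S) ≤ (N - Z.card) * (S - t) := by
      apply mul_le_mul <;> nlinarith
    have h2 : w * (N * (K * t) + (M : ℝ) ^ 2) ≤ (1 + δ / 4) * (N * S) := by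
      have : w * (N * (K * t) + (M : ℝ) ^ 2) = N * S + w * (M : ℝ) ^ 2 := by rw [hS]; ring
      linarith
    have h3 := mul_le_mul_of_nonneg_left h2 (sub_nonneg.2 hδ1.le)
    have h4 : (1 - δ / 2) * (1 - δ / 8) * (N * S) ≤ (1 - δ) * (1 + δ / 4) * (N * S) := by
      linarith
    have h5 := le_of_mul_le_mul_right h4 hNS
    nlinarith
  have hρ : δ / 2 ≤ (1 - 1 / (c + 1 : ℝ) ^ 2) ^ r := by
    have h1 := hZ.trans H.card_hidden
    rw [mul_comm] at h1
    exact le_of_mul_le_mul_left h1 hN0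
  have hc : (0 : ℝ) < (c + 1 : ℝ) ^ 2 := by positivity
  have hρ0 : (0 : ℝ) ≤ 1 - 1 / (c + 1 : ℝ) ^ 2 := by
    rw [sub_nonneg, div_le_one hc]
    exact one_le_pow₀ (by linarith [Nat.cast_nonneg (α := ℝ) c])
  have hr : r ≤ r₀ := by
    by_contra! hcon
    have := pow_le_pow_of_le_one hρ0 (by have := one_div_pos.2 hc; linarith) hcon.le
    linarith
  have hr' : (r : ℝ) ≤ r₀ := by exact_mod_cast hr
  have hD : (D.card : ℝ) ≤ 2 * r := by exact_mod_cast H.card_dead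
  linarith

/-- Bins of all sizes `w ≤ W` with a common unit of cost and a common keyspace. -/
theorem exists_bins {δ : ℝ} (hδ : 0 < δ) (hδ1 : δ < 1) (W : ℕ) :
    ∃ T M : ℕ, 0 < T ∧ 0 < M ∧ ∀ w : ℕ, 0 < w → w ≤ W → ∃ (m : ℕ) (B : BinFunction m M),
      Computes B (w * T) ∧
      (∀ k, Computes (fun y => decide (B y = some k)) (δ * (w * T))) ∧
      B.Fools ((1 - δ) * (w * T)) δ := by
  obtain ⟨c, hc⟩ := exists_nat_ge (2 / δ)
  have hcδ : 2 ≤ δ * (c + 1) := by rw [div_le_iff₀ hδ] at hc; nlinarith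
  obtain ⟨r₀, hr₀⟩ := exists_pow_lt_of_lt_one (half_pos hδ)
    (show (1 - 1 / (c + 1 : ℝ) ^ 2) < 1 by
      have : (0 : ℝ) < 1 / (c + 1 : ℝ) ^ 2 := by positivity
      linarith)
  obtain ⟨M, hM⟩ := exists_nat_ge (max (2 * r₀ / δ) (2 / (1 - δ)))
  have hM1 : 2 * (r₀ : ℝ) ≤ δ * M := by
    have := (le_max_left _ _).trans hM
    rwa [div_le_iff₀ hδ, mul_comm (M : ℝ)] at this
  have hM2 : δ * M + 2 ≤ M := by
    have := (le_max_right _ _).trans hM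
    rw [div_le_iff₀ (by linarith)] at this
    linarith
  have hM0 : 0 < M := by
    have : (0 : ℝ) < M := by nlinarith [Nat.cast_nonneg (α := ℝ) M]
    exact_mod_cast this
  obtain ⟨K, hK⟩ := exists_nat_ge (8 / δ)
  have hK' : 8 ≤ δ * K := by rwa [div_le_iff₀ hδ, mul_comm (K : ℝ)] at hK
  have hK0 : (0 : ℝ) < K := by nlinarith
  obtain ⟨t, ht, ht1, ht2⟩ := exists_parameters (max (4 * M ^ 2 / δ) (4 * M / δ)) W ((M : ℝ) ^ 2)
    (show 0 < (c + 1 : ℝ) ^ M * K by positivity)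
  rw [mul_assoc] at ht1 ht2
  have ht3 := (le_max_left _ _).trans ht1
  have ht4 := (le_max_right _ _).trans ht1
  rw [div_le_iff₀ hδ, mul_comm _ δ] at ht3 ht4
  refine ⟨(c + 1) ^ M * (K * t) + M ^ 2, M, by positivity, hM0, fun w hw hwW =>
    ⟨_, winnerBin M c (w * (K * t)), ?_, fun k => ?_, ?_⟩⟩
  all_goals
    have hw1 : (1 : ℝ) ≤ w := by exact_mod_cast hw
    have hwW' : (w : ℝ) ≤ W := by exact_mod_cast hwW
    push_cast
  · refine ((computes_winner M c (w * (K * t))).relabel _).mono ?_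
    push_cast
    nlinarith [mul_nonneg (sub_nonneg.2 hw1) (sq_nonneg (M : ℝ))]
  · refine ((computes_winner_eq M c (w * (K * t)) k).relabel _).mono ?_
    push_cast
    set N : ℝ := (c + 1 : ℝ) ^ M with hN
    have hN0 : 0 < N := by positivity
    have h1 : N * (w * (K * t)) / (c + 1) ≤ δ / 2 * (w * (N * (K * t))) := by
      rw [div_le_iff₀ (by positivity)]
      have : 0 ≤ N * (w * (K * t)) := by positivity
      nlinarith
    have h2 : δ * (N * (K * t)) ≤ w * (δ * (N * (K * t))) :=
      le_mul_of_one_le_left (by positivity) hw1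
    have h3 : 0 ≤ δ * (w * (M : ℝ) ^ 2) := by positivity
    linarith
  · refine fools_winnerBin (t := t) (lt_of_le_of_lt ?_ ht2) (fun h L D Z r H hlen =>
      card_dead_le hδ hδ1 hw ht hK' ht3 hr₀ hM1 H hlen) hM2
    set T : ℝ := (c + 1 : ℝ) ^ M * (K * t) + (M : ℝ) ^ 2 with hT
    have hT0 : 0 ≤ T := by positivity
    have h1 : (w : ℝ) * T ≤ W * T := by gcongr
    have h2 : 0 ≤ (w : ℝ) * T := by positivity
    nlinarith

end Multitask

namespace Multitask

variable {U : Type*} [Fintype U] {n M : ℕ} {m : U → ℕ}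

/-- Histories of the single bins that leave all keys but a small fraction possible for each of the
bins in `s` do not determine whether these bins have the same contents. -/
theorem exists_agreeing_inputs (e : (Σ u : U, Fin (m u)) ≃ Fin n)
    (B : ∀ u : U, BinFunction (m u) M) (hs : ∀ u, List (Fin (m u) × Bool))
    {δ : ℝ} (hδ0 : 0 < δ) (hδ : δ * Fintype.card U < 1) (hM : 0 < M)
    (hagree : ∀ u, ∃ y : Fin (m u) → Bool, ∀ a ∈ hs u, y a.1 = a.2)
    {s : Finset U} (hne : s.Nonempty)
    (hkey : ∀ u ∈ s, ∃ D : Finset (Fin M), (D.card : ℝ) ≤ δ * M ∧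
        ∀ k, k ∉ D → ∃ y : Fin (m u) → Bool, (∀ a ∈ hs u, y a.1 = a.2) ∧ B u y = some k)
    (hnone : ∀ u ∈ s, ∃ y : Fin (m u) → Bool, (∀ a ∈ hs u, y a.1 = a.2) ∧ B u y = none) :
    (∃ x : Fin n → Bool, (∀ u, ∀ a ∈ hs u, x (e ⟨u, a.1⟩) = a.2) ∧
      ∃ k, ∀ u ∈ s, B u (fun j => x (e ⟨u, j⟩)) = some k) ∧
    ∃ x : Fin n → Bool, (∀ u, ∀ a ∈ hs u, x (e ⟨u, a.1⟩) = a.2) ∧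
      ¬ ∃ k, ∀ u ∈ s, B u (fun j => x (e ⟨u, j⟩)) = some k := by
  classical
  have glue : ∀ y : ∀ u, Fin (m u) → Bool, ∃ x : Fin n → Bool,
      ∀ u j, x (e ⟨u, j⟩) = y u j := fun y =>
    ⟨fun i => y (e.symm i).1 (e.symm i).2, fun u j =>
      congrArg (fun p : Σ u, Fin (m u) => y p.1 p.2) (e.symm_apply_apply ⟨u, j⟩)⟩
  choose y₀ hy₀ using hagree
  constructor
  · choose D hD hDy using hkey
    obtain ⟨k, hk⟩ : ((s.attach.biUnion fun u => D u.1 u.2)ᶜ).Nonempty := by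
      rw [← Finset.card_pos, Finset.card_compl, Fintype.card_fin, Nat.sub_pos_iff_lt]
      have h1 : ((s.attach.biUnion fun u => D u.1 u.2).card : ℝ) ≤
          ∑ u ∈ s.attach, ((D u.1 u.2).card : ℝ) := by
        exact_mod_cast Finset.card_biUnion_le
      have h2 : ∑ u ∈ s.attach, ((D u.1 u.2).card : ℝ) ≤ s.card * (δ * M) := by
        refine (Finset.sum_le_sum fun u _ => hD u.1 u.2).trans ?_
        rw [Finset.sum_const, nsmul_eq_mul, Finset.card_attach]
      have h3 : (s.card : ℝ) ≤ Fintype.card U := by exact_mod_cast s.card_le_univ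
      have hM' : (0 : ℝ) < M := by exact_mod_cast hM
      have h4 : (s.card : ℝ) * (δ * M) ≤ Fintype.card U * (δ * M) := by gcongr
      have h5 : (Fintype.card U : ℝ) * (δ * M) < M := by nlinarith
      exact_mod_cast (h1.trans (h2.trans h4)).trans_lt h5
    have hk' : ∀ u (hu : u ∈ s), k ∉ D u hu := fun u hu hkD =>
      Finset.mem_compl.1 hk (Finset.mem_biUnion.2 ⟨⟨u, hu⟩, by simp, hkD⟩)
    choose y hy hyk using fun u hu => hDy u hu k (hk' u hu)
    obtain ⟨x, hx⟩ := glue fun u => if hu : u ∈ s then y u hu else y₀ u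
    refine ⟨x, fun u a ha => ?_, k, fun u hu => ?_⟩
    · rw [hx]
      split_ifs with hu
      · exact hy u hu a ha
      · exact hy₀ u a ha
    · simp only [hx, dif_pos hu]
      exact hyk u hu
  · obtain ⟨u₀, hu₀⟩ := hne
    obtain ⟨y, hy, hyn⟩ := hnone u₀ hu₀
    obtain ⟨x, hx⟩ := glue (Function.update y₀ u₀ y)
    refine ⟨x, fun u a ha => ?_, ?_⟩
    · rw [hx]
      by_cases hu : u = u₀
      · subst hu; simpa using hy a ha
      · simpa [hu] using hy₀ u a ha
    · rintro ⟨k, hk⟩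
      have := hk u₀ hu₀
      simp only [hx, Function.update_self, hyn] at this
      simp at this

/-- The adversaries of the bins are run side by side. If the bins that get more queries than their
adversary can deal with do not meet `s`, then it is open whether the bins in `s` have the same
contents. -/
theorem exists_global_invariant (e : (Σ u : U, Fin (m u)) ≃ Fin n)
    (B : ∀ u : U, BinFunction (m u) M) {δ : ℝ} (hδ0 : 0 < δ) (hδ : δ * Fintype.card U < 1)
    (hM : 0 < M) {q : U → ℝ} (hB : ∀ u, (B u).Fools (q u) δ) :
    ∃ Good : List (Fin n × Bool) → Prop, Good [] ∧ (∀ h i, Good h → ∃ b, Good ((i, b) :: h)) ∧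
      ∀ h, Good h → ∃ G : Finset U, ∑ u ∈ G, q u ≤ h.length ∧
        ∀ s : Finset U, s.Nonempty → (∀ u ∈ G, u ∉ s) →
          (∃ x : Fin n → Bool, (∀ a ∈ h, x a.1 = a.2) ∧
            ∃ k, ∀ u ∈ s, B u (fun j => x (e ⟨u, j⟩)) = some k) ∧
          ∃ x : Fin n → Bool, (∀ a ∈ h, x a.1 = a.2) ∧
            ¬ ∃ k, ∀ u ∈ s, B u (fun j => x (e ⟨u, j⟩)) = some k := by
  classical
  choose Good h0 hstep hG using hB
  have hagree : ∀ u h, Good u h → (h.length : ℝ) ≤ q u →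
      ∃ y : Fin (m u) → Bool, ∀ a ∈ h, y a.1 = a.2 := fun u h hh hl => by
    obtain ⟨-, y, hy, -⟩ := hG u h hh hl
    exact ⟨y, hy⟩
  have hQ : ∀ u (h : List (Fin (m u) × Bool)) j,
      (((h.length : ℝ) ≤ q u → Good u h) ∧ ∃ y : Fin (m u) → Bool, ∀ a ∈ h, y a.1 = a.2) →
      ∃ b, (((((j, b) :: h).length : ℝ) ≤ q u → Good u ((j, b) :: h)) ∧
        ∃ y : Fin (m u) → Bool, ∀ a ∈ (j, b) :: h, y a.1 = a.2) := by
    rintro u h j ⟨h1, y, hy⟩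
    by_cases hl : ((h.length + 1 : ℕ) : ℝ) ≤ q u
    · obtain ⟨b, hb⟩ := hstep u h j (h1 (le_trans (by push_cast; linarith) hl))
      exact ⟨b, fun _ => hb, hagree u _ hb (by simpa using hl)⟩
    · refine ⟨y j, fun hl' => absurd (by simpa using hl') hl, y, fun a ha => ?_⟩
      rcases List.mem_cons.1 ha with rfl | ha
      exacts [rfl, hy a ha]
  refine ⟨fun h => ∃ hs : ∀ u, List (Fin (m u) × Bool),
    (∀ u j b, (e ⟨u, j⟩, b) ∈ h → (j, b) ∈ hs u) ∧ ∑ u, (hs u).length ≤ h.length ∧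
    ∀ u, (((hs u).length : ℝ) ≤ q u → Good u (hs u)) ∧
      ∃ y : Fin (m u) → Bool, ∀ a ∈ hs u, y a.1 = a.2, ?_, ?_, ?_⟩
  · exact ⟨fun _ => [], by simp, by simp, fun u => ⟨fun _ => h0 u, fun _ => false, by simp⟩⟩
  · rintro h i ⟨hs, hmem, hlen, hgood⟩
    obtain ⟨⟨u, j⟩, rfl⟩ := e.surjective i
    obtain ⟨b, hb⟩ := hQ u (hs u) j (hgood u)
    refine ⟨b, Function.update hs u ((j, b) :: hs u), ?_, ?_, ?_⟩
    · intro u' j' b' hmem'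
      rcases List.mem_cons.1 hmem' with hm | hm
      · simp only [Prod.mk.injEq, EmbeddingLike.apply_eq_iff_eq, Sigma.mk.injEq] at hm
        obtain ⟨⟨rfl, hj⟩, rfl⟩ := hm
        rw [eq_of_heq hj, Function.update_self]
        exact List.mem_cons_self
      · by_cases hu : u' = u
        · subst hu
          rw [Function.update_self]
          exact List.mem_cons_of_mem _ (hmem _ _ _ hm)
        · rw [Function.update_of_ne hu]
          exact hmem _ _ _ hm
    · have h1 : ∀ u', (Function.update hs u ((j, b) :: hs u) u').length =
          (hs u').length + if u' = u then 1 else 0 := by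
        intro u'
        by_cases hu : u' = u
        · subst hu; simp
        · simp [hu]
      rw [Finset.sum_congr rfl fun u' _ => h1 u', Finset.sum_add_distrib,
        Finset.sum_ite_eq' Finset.univ u, if_pos (Finset.mem_univ u), List.length_cons]
      exact Nat.succ_le_succ hlen
    · intro u'
      by_cases hu : u' = u
      · subst hu
        rw [Function.update_self]
        exact hb
      · rw [Function.update_of_ne hu]
        exact hgood u'
  · rintro h ⟨hs, hmem, hlen, hgood⟩
    refine ⟨Finset.univ.filter fun u => q u < (hs u).length, ?_, fun s hne hdisj => ?_⟩
    · calc _ ≤ ∑ u ∈ Finset.univ.filter (fun u => q u < (hs u).length), ((hs u).length : ℝ) :=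
            Finset.sum_le_sum fun u hu => (Finset.mem_filter.1 hu).2.le
        _ ≤ ∑ u, ((hs u).length : ℝ) :=
            Finset.sum_le_sum_of_subset_of_nonneg (Finset.subset_univ _) fun _ _ _ => by positivity
        _ ≤ h.length := by exact_mod_cast hlen
    · have hle : ∀ u ∈ s, ((hs u).length : ℝ) ≤ q u := fun u hu => by
        by_contra! hcon
        exact hdisj u (by simpa using hcon) hu
      have hgo : ∀ x : Fin n → Bool, (∀ u, ∀ a ∈ hs u, x (e ⟨u, a.1⟩) = a.2) →
          ∀ a ∈ h, x a.1 = a.2 := by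
        rintro x hx ⟨i, b⟩ ha
        obtain ⟨⟨u, j⟩, rfl⟩ := e.surjective i
        exact hx u _ (hmem u j b ha)
      obtain ⟨⟨x, hx, hk⟩, x', hx', hk'⟩ := exists_agreeing_inputs e B hs hδ0 hδ hM
        (fun u => (hgood u).2) hne
        (fun u hu => (hG u _ ((hgood u).1 (hle u hu)) (hle u hu)).1)
        (fun u hu => (hG u _ ((hgood u).1 (hle u hu)) (hle u hu)).2)
      exact ⟨⟨x, hgo x hx, hk⟩, x', hgo x' hx', hk'⟩

theorem exists_hittingSet_of_hittingSetCost {l : ℕ} (A : Fin l → Finset U)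
    (hA : ∀ i, (A i).Nonempty) (w : U → ℕ) (X : Fin l → Bool) :
    ∃ H : Finset U, (∀ i, X i = true → ∃ u ∈ H, u ∈ A i) ∧
      ∑ u ∈ H, w u ≤ hittingSetCost w A X := by
  obtain ⟨H₀, hH₀⟩ := exists_isHittingSet {S | ∃ i, X i = true ∧ A i = S} (by
    rintro S ⟨i, -, rfl⟩; exact hA i)
  have hne : {c : ℕ | ∃ H : Finset U, IsHittingSet H {S | ∃ i, X i = true ∧ A i = S} ∧
      ∑ u ∈ H, w u ≤ c}.Nonempty := ⟨_, H₀, hH₀, le_rfl⟩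
  obtain ⟨H, h1, h2⟩ := Nat.sInf_mem hne
  exact ⟨H, fun i hi => h1 _ ⟨i, hi, rfl⟩, h2⟩

theorem hittingSetCost_le {V : Type*} {l : ℕ} {A : Fin l → Finset V} {w : V → ℕ}
    {X : Fin l → Bool} {H : Finset V} (hH : ∀ i, X i = true → ∃ u ∈ H, u ∈ A i) :
    hittingSetCost w A X ≤ ∑ u ∈ H, w u := by
  refine Nat.sInf_le ⟨H, ?_, le_rfl⟩
  rintro S ⟨i, hi, rfl⟩
  exact hH i hi

theorem le_multitaskCost {l : ℕ} {A : Fin l → Finset U} (hA : ∀ i, (A i).Nonempty)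
    {w : U → ℕ} {f : Fin l → (Fin n → Bool) → Bool} (e : (Σ u : U, Fin (m u)) ≃ Fin n)
    (B : ∀ u : U, BinFunction (m u) M)
    (hf : ∀ i x, f i x = true ↔ ∃ k, ∀ u ∈ A i, B u (fun j => x (e ⟨u, j⟩)) = some k)
    {T δ : ℝ} (hT : 0 ≤ T) (hδ0 : 0 < δ) (hδ1 : δ < 1) (hδ : δ * Fintype.card U < 1) (hM : 0 < M)
    (hB : ∀ u, (B u).Fools ((1 - δ) * (w u * T)) δ) (X : Fin l → Bool) :
    (hittingSetCost w A X : ℝ) * (T * (1 - δ)) ≤ multitaskCost f X := by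
  obtain ⟨Good, h0, hs, hG⟩ := exists_global_invariant e B hδ0 hδ hM hB
  obtain ⟨σ, hσ⟩ := DecisionTree.exists_adversary hs
  obtain ⟨P, hP, hPe⟩ := exists_depth_eq_queryComplexity
    fun (x : Fin n → Bool) (i : {i : Fin l // X i = true}) => f i x
  obtain ⟨G, hsum, hopen⟩ := hG _ (DecisionTree.transcript_induction hσ P [] h0)
  have hhit : ∀ i, X i = true → ∃ u ∈ G, u ∈ A i := by
    intro i hi
    by_contra! hcon
    obtain ⟨⟨x, hx, h1⟩, x', hx', h2⟩ := hopen (A i) (hA i) hcon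
    have heq := DecisionTree.eval_eq_of_transcript σ P [] hx hx'
    rw [hPe, hPe] at heq
    have := congrFun heq ⟨i, hi⟩
    simp only at this
    rw [← hf, ← this, hf] at h2
    exact h2 h1
  have h1 : (hittingSetCost w A X : ℝ) ≤ ∑ u ∈ G, (w u : ℝ) := by
    exact_mod_cast hittingSetCost_le hhit
  have h2 : ((P.transcript σ []).length : ℝ) ≤ P.depth := by
    exact_mod_cast DecisionTree.length_transcript_le σ P []
  rw [hP] at h2
  refine le_trans ?_ (hsum.trans h2)
  rw [← Finset.mul_sum, ← Finset.sum_mul]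
  have h3 : 0 ≤ T * (1 - δ) := mul_nonneg hT (sub_nonneg.2 hδ1.le)
  nlinarith [mul_le_mul_of_nonneg_right h1 h3]

theorem multitaskCost_le {l : ℕ} {A : Fin l → Finset U} (hA : ∀ i, (A i).Nonempty)
    {w : U → ℕ} (hw : ∀ u, 0 < w u) {f : Fin l → (Fin n → Bool) → Bool}
    (e : (Σ u : U, Fin (m u)) ≃ Fin n) (B : ∀ u : U, BinFunction (m u) M)
    (hf : ∀ i x, f i x = true ↔ ∃ k, ∀ u ∈ A i, B u (fun j => x (e ⟨u, j⟩)) = some k)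
    {T δ ε : ℝ} (hT : 0 ≤ T) (hδ0 : 0 ≤ δ) (hε : δ * (l * ∑ u, (w u : ℝ)) ≤ ε)
    (hcomp : ∀ u, Computes (B u) (w u * T))
    (hcheck : ∀ u k, Computes (fun y => decide (B u y = some k)) (δ * (w u * T)))
    (X : Fin l → Bool) :
    (multitaskCost f X : ℝ) ≤ hittingSetCost w A X * (T * (1 + ε)) := by
  classical
  obtain ⟨H, hH, hHw⟩ := exists_hittingSet_of_hittingSetCost A hA w X
  by_cases hX : ∀ i, X i = false
  · have : (multitaskCost f X : ℝ) ≤ 0 := by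
      have : IsEmpty {i : Fin l // X i = true} := ⟨fun i => by simpa [hX] using i.2⟩
      refine queryComplexity_le ?_
      convert Computes.const (ι := Fin n) (fun i : {i : Fin l // X i = true} => false) le_rfl
        using 3 with x i
    have hε0 : 0 ≤ ε := le_trans (by positivity) hε
    exact this.trans (by positivity)
  push Not at hX
  obtain ⟨i₀, hi₀⟩ := hX
  have hC : (1 : ℝ) ≤ hittingSetCost w A X := by
    obtain ⟨u, hu, -⟩ := hH i₀ (by simpa using hi₀)
    have := (Finset.single_le_sum (fun v _ => Nat.zero_le (w v)) hu).trans hHw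
    exact_mod_cast (hw u).trans_le this
  choose v hvH hvA using fun i : {i : Fin l // X i = true} => hH i.1 i.2
  have hbins : Computes (fun (x : Fin n → Bool) u => if u ∈ H then B u (fun j => x (e ⟨u, j⟩))
      else none) (∑ u ∈ H, (w u : ℝ) * T) :=
    Computes.table none H fun u _ => (hcomp u).relabel fun j => e ⟨u, j⟩
  let g (c : U → Option (Fin M)) (p : {i : Fin l // X i = true} × U) (x : Fin n → Bool) : Bool :=
    match c (v p.1) with
    | none => false
    | some k => decide (B p.2 (fun j => x (e ⟨p.2, j⟩)) = some k)
  have hg : ∀ c p, Computes (g c p) (δ * (w p.2 * T)) := by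
    intro c p
    cases hc : c (v p.1) with
    | none =>
      have : g c p = fun _ => false := by funext x; simp only [g, hc]
      rw [this]
      exact Computes.const _ (by positivity)
    | some k =>
      have : g c p = fun x => decide (B p.2 (fun j => x (e ⟨p.2, j⟩)) = some k) := by
        funext x; simp only [g, hc]
      rw [this]
      exact (hcheck p.2 k).relabel fun j => e ⟨p.2, j⟩
  have hall := hbins.bind fun c => (Computes.table false Finset.univ fun p _ => hg c p).comp
    fun F (i : {i : Fin l // X i = true}) => decide (∀ u ∈ A i, F (i, u) = true)
  have hcost : (multitaskCost f X : ℝ) ≤ ∑ u ∈ H, (w u : ℝ) * T +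
      ∑ p : {i : Fin l // X i = true} × U, δ * (w p.2 * T) := by
    refine queryComplexity_le ?_
    convert hall using 3 with x i
    rw [Bool.eq_iff_iff, hf, decide_eq_true_iff]
    have hgx : ∀ u, g (fun u => if u ∈ H then B u (fun j => x (e ⟨u, j⟩)) else none) (i, u) x =
        match B (v i) (fun j => x (e ⟨v i, j⟩)) with
        | none => false
        | some k => decide (B u (fun j => x (e ⟨u, j⟩)) = some k) := by
      intro u
      simp only [g, if_pos (hvH i)]
    simp only [Finset.mem_univ, if_true, hgx]
    constructor
    · rintro ⟨k, hk⟩ u hu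
      rw [hk _ (hvA i)]
      simpa using hk u hu
    · intro hall
      cases hc : B (v i) (fun j => x (e ⟨v i, j⟩)) with
      | none =>
        have := hall _ (hvA i)
        rw [hc] at this
        simp at this
      | some k =>
        refine ⟨k, fun u hu => ?_⟩
        have := hall u hu
        rw [hc] at this
        simpa using this
  refine hcost.trans ?_
  have h1 : ∑ u ∈ H, (w u : ℝ) * T ≤ hittingSetCost w A X * T := by
    rw [← Finset.sum_mul]
    exact mul_le_mul_of_nonneg_right (by exact_mod_cast hHw) hT
  have h2 : ∑ p : {i : Fin l // X i = true} × U, δ * ((w p.2 : ℝ) * T) ≤ ε * T := by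
    simp only [Fintype.sum_prod_type, Finset.sum_const, nsmul_eq_mul, ← Finset.mul_sum,
      ← Finset.sum_mul, Finset.card_univ]
    have hcard : (Fintype.card {i : Fin l // X i = true} : ℝ) ≤ l := by
      have := Fintype.card_subtype_le fun i : Fin l => X i = true
      rw [Fintype.card_fin] at this
      exact_mod_cast this
    calc _ = (Fintype.card {i : Fin l // X i = true} : ℝ) * (δ * ((∑ u, (w u : ℝ)) * T)) := by
          ring
      _ ≤ (l : ℝ) * (δ * ((∑ u, (w u : ℝ)) * T)) := by gcongr
      _ = δ * (l * ∑ u, (w u : ℝ)) * T := by ring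
      _ ≤ ε * T := by gcongr
  have hε0 : 0 ≤ ε := le_trans (by positivity) hε
  have h3 : ε * T ≤ hittingSetCost w A X * (ε * T) := le_mul_of_one_le_left (by positivity) hC
  linarith

end Multitask

theorem mainTheorem4 {U : Type*} [Fintype U] {l : ℕ} (A : Fin l → Finset U)
    (hA : ∀ i, (A i).Nonempty) (w : U → ℕ) (hw : ∀ u, 0 < w u)
    (ε : ℝ) (hε : 0 < ε) (δ : ℝ) (hδ0 : 0 < δ) (hδ1 : δ < 1) :
    ∃ (n T M : ℕ) (m : U → ℕ) (e : (Σ u : U, Fin (m u)) ≃ Fin n)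
      (B : ∀ u : U, Multitask.BinFunction (m u) M)
      (f : Fin l → (Fin n → Bool) → Bool),
      0 < T ∧ 0 < M ∧
      (∀ u, (B u).IsMysteryBin ((w u : ℝ) * T) δ) ∧
      (∀ i x, f i x = true ↔ ∃ k : Fin M, ∀ u ∈ A i, B u (fun j => x (e ⟨u, j⟩)) = some k) ∧
      (∀ i, ∃ x y, f i x ≠ f i y) ∧
      ∀ X : Fin l → Bool,
        (Multitask.hittingSetCost w A X : ℝ) * (T * (1 - ε)) ≤ Multitask.multitaskCost f X ∧
        (Multitask.multitaskCost f X : ℝ) ≤ Multitask.hittingSetCost w A X * (T * (1 + ε)) := by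
  classical
  set W : ℝ := ∑ u, (w u : ℝ) with hW
  have hW0 : 0 ≤ W := by positivity
  have hlW : 0 ≤ (l : ℝ) * W := by positivity
  have hcU : 0 ≤ (Fintype.card U : ℝ) := Nat.cast_nonneg _
  obtain ⟨d, hd0, hdδ, hdε⟩ : ∃ d : ℝ, 0 < d ∧ d ≤ δ ∧
      d * (l * W + Fintype.card U + 2) ≤ min ε 1 := by
    refine ⟨min δ (min ε 1 / (l * W + Fintype.card U + 2)), by positivity, min_le_left _ _, ?_⟩
    rw [← le_div_iff₀ (by positivity)]
    exact min_le_right _ _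
  have hdε1 := hdε.trans (min_le_left _ _)
  have hdε2 := hdε.trans (min_le_right _ _)
  have hdl := mul_nonneg hd0.le hlW
  have hdU := mul_nonneg hd0.le hcU
  have hd1 : d < 1 := hdδ.trans_lt hδ1
  obtain ⟨T, M, hT, hM, hbins⟩ := Multitask.exists_bins hd0 hd1 (∑ u, w u)
  choose m B hcomp hcheck hfool using fun u => hbins (w u) (hw u)
    (Finset.single_le_sum (fun v _ => Nat.zero_le (w v)) (Finset.mem_univ u))
  have hT' : (0 : ℝ) < T := by exact_mod_cast hT
  have hwT : ∀ u, 0 < (w u : ℝ) * T := fun u => mul_pos (by exact_mod_cast hw u) hT'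
  let e := Fintype.equivFin (Σ u : U, Fin (m u))
  have hf : ∀ i (x : Fin (Fintype.card (Σ u : U, Fin (m u))) → Bool), decide (∃ k : Fin M, ∀ u ∈ A i, B u (fun j => x (e ⟨u, j⟩)) = some k) = true ↔
      ∃ k : Fin M, ∀ u ∈ A i, B u (fun j => x (e ⟨u, j⟩)) = some k := fun i x => decide_eq_true_iff
  refine ⟨_, T, M, m, e, B, fun i x =>
    decide (∃ k : Fin M, ∀ u ∈ A i, B u (fun j => x (e ⟨u, j⟩)) = some k), hT, hM, fun u => ?_,
    hf, fun i => ?_, fun X => ⟨?_, ?_⟩⟩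
  · refine ⟨hwT u, hδ0, hδ1, hcomp u, fun k => ?_, ?_⟩
    · obtain ⟨P, hP, hPe⟩ := hcheck u k
      exact ⟨P, hP.trans (mul_le_mul_of_nonneg_right hdδ (hwT u).le), fun y => by
        rw [hPe, decide_eq_true_iff]⟩
    · exact ((hfool u).mono (mul_le_mul_of_nonneg_right (by linarith) (hwT u).le) hdδ).secure
        (mul_nonneg (by linarith) (hwT u).le)
  · have hfool' := fun u => ((hfool u).mono (q' := 0)
      (mul_nonneg (by linarith) (hwT u).le) le_rfl)
    choose Good h0 _ hG using hfool'
    obtain ⟨⟨x, -, hx⟩, x', -, hx'⟩ := Multitask.exists_agreeing_inputs e B (fun _ => []) hd0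
      (by linarith) hM (fun u => ⟨fun _ => false, by simp⟩) (hA i)
      (fun u _ => (hG u [] (h0 u) (by simp)).1) (fun u _ => (hG u [] (h0 u) (by simp)).2)
    refine ⟨x, x', ?_⟩
    simp only [hx, hx', decide_true, decide_false]
    simp
  · refine le_trans ?_ (Multitask.le_multitaskCost hA e B hf hT'.le hd0 hd1 (by linarith) hM
      hfool X)
    gcongr
    linarith
  · exact Multitask.multitaskCost_le hA hw e B hf hT'.le hd0.le (by linarith) hcomp hcheck X
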